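/- Fix a dimension $n\ge 1$ and $p\in(1,2]$. There is a constant $c=c(p)>0$, depending only on $p$ (and on the fixed dimension $n$), with the following property. Let $\alpha,\beta>0$, let $u_0\in L^2(\mathbb R^n;\mathbb C)$, and let $u\in C([0,\infty);L^2(\mathbb R^n))$ be the solution of the free Schrödinger equation $$\partial_t u=i\Delta u\quad (t>0,\ x\in\mathbb R^n),\qquad u(0)=u_0,$$ the equation being understood in the sense of distributions in $x$. Write $\|\cdot\|_2$ for the $L^2(\mathbb R^n)$ norm, with the value $+\infty$ for functions that are not in $L^2$, and $$\widehat f(\xi)=(2\pi)^{-n/2}\int_{\mathbb R^n}e^{-ix\cdot\xi}f(x)\,dx$$ for the Fourier transform, extended to $L^2$ by Plancherel's theorem. Then: (i) for all $T>0$ and $0\le t\le T$, with $\theta(t)=\dfrac{\beta(T-t)}{T(\alpha t+\beta)}$, $$\Big\|e^{\left|\frac{x}{\alpha t+\beta}\right|^p}u(t)\Big\|_2\le c\,\Big\|e^{\left|\frac{x}{\beta}\right|^p}u_0\Big\|_2^{\theta(t)}\,\Big\|e^{\left|\frac{x}{\alpha T+\beta}\right|^p}u(T)\Big\|_2^{1-\theta(t)};$$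 (ii) for all $t\ge 0$, with $\mu(t)=\dfrac{\beta}{\alpha t+\beta}$, $$\Big\|e^{\left|\frac{x}{\alpha t+\beta}\right|^p}u(t)\Big\|_2\le c\,\Big\|e^{\left|\frac{x}{\beta}\right|^p}u_0\Big\|_2^{\mu(t)}\,\Big\|e^{\left|\frac{2\xi}{\alpha}\right|^p}\widehat u_0\Big\|_2^{1-\mu(t)}.$$ In particular, in each inequality, if the right-hand side is finite then so is the left-hand side. (Conventions: $a^0=1$ for all $a\in[0,\infty]$, and $0\cdot\infty=0$.) -/

import Mathlib

open MeasureTheory Set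
open scoped SchwartzMap FourierTransform Laplacian ENNReal

noncomputable section

/-- The space `L²(ℝⁿ; ℂ)`, for Lebesgue measure on Euclidean space. -/
abbrev L2 (n : ℕ) : Type := Lp (α := EuclideanSpace ℝ (Fin n)) ℂ 2 volume

/-- `u ∈ C([0,∞); L²(ℝⁿ))` is the solution of the initial value problem
`∂ₜ u = i Δ u` for `t > 0`, `u(0) = u₀`, the equation being understood in the sense of
(tempered) distributions in `x`. The values of `u` at negative times play no role. -/
structure IsFreeSchrodingerSolution {n : ℕ} (u₀ : L2 n) (u : ℝ → L2 n) : Prop where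
  continuousOn : ContinuousOn u (Ici 0)
  initial : u 0 = u₀
  equation : ∀ φ : 𝓢(EuclideanSpace ℝ (Fin n), ℂ), ∀ t : ℝ, 0 < t →
    HasDerivAt (fun s : ℝ => ∫ x, u s x * φ x) (Complex.I * ∫ x, u t x * (Δ φ) x) t

/-- The Fourier transform on `L²(ℝⁿ)` in the unitary angular-frequency normalization
`f̂(ξ) = (2π)^(-n/2) ∫ exp(-i x·ξ) f(x) dx`. Mathlib's Fourier transform `𝓕`, extended to `L²` by
Plancherel's theorem, has kernel `exp(-2πi x·ξ)`, whence `f̂(ξ) = (2π)^(-n/2) (𝓕 f)(ξ / 2π)`. -/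
def angularFourier {n : ℕ} (f : L2 n) (ξ : EuclideanSpace ℝ (Fin n)) : ℂ :=
  (((2 * Real.pi) ^ (-(n : ℝ) / 2) : ℝ) : ℂ) * (𝓕 f : L2 n) ((2 * Real.pi)⁻¹ • ξ)

/-- The weighted norm `‖exp(|r x|^p) f‖₂`, with value `∞` when `exp(|r x|^p) f ∉ L²`. -/
def expPowNorm {n : ℕ} (p r : ℝ) (f : EuclideanSpace ℝ (Fin n) → ℂ) : ℝ≥0∞ :=
  eLpNorm (fun x => ((Real.exp (‖r • x‖ ^ p) : ℝ) : ℂ) * f x) 2 volume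

/-- `θ(t) = β (T - t) / (T (α t + β))`. -/
def thetaExp (α β T t : ℝ) : ℝ := β * (T - t) / (T * (α * t + β))

/-- `μ(t) = β / (α t + β)`. -/
def muExp (α β t : ℝ) : ℝ := β / (α * t + β)

end

/-! The proof first treats linear weights `exp (l · x)` and then averages over `l`. For linear
weights, `u t` is, up to a constant factor, a unimodular chirp and a dilation, the Fourier transform
of `exp (i|x|²/(4t)) u₀`. A real exponential weight on the Fourier side is a translation by an
imaginary vector on the other side, and such a translation turns a chirp into itself times a real
exponential and a phase. Hence, for `η = (π/k) ν` and `g = exp (ν · x) v`, the functions `exp (η ·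
ξ) 𝓕 (exp (ik|x|²) v)` and `exp (η · ξ) 𝓕 g` have the same norm (`eLpNorm_expLin_fourier_chirp`).
The second function involves `k` only through the linear weight, so Hölder's inequality gives
log-convexity in `1/k`. Taking `v = exp (-iα|x|²/(4β)) u₀` and `k = 1/(4t) + α/(4β)` produces the
weights `l/(αt+β)` and the exponents `θ` and `μ`; in (ii) the endpoint is `k = α/(4β)`, where the
two chirps cancel and `𝓕 u₀` remains. For the power weights, `exp (2|y|^p)` is comparable to a
Gaussian superposition of linear exponentials (`superExp_le`, `le_superExp`), because the Bregman
divergence of `|·|^p` is comparable to a squared distance in the coordinates `|y|^(p/2-1) y`. A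
second use of Hölder, now in the superposition variable, transfers the log-convexity with a constant
depending only on `n` and `p`. All operator identities are checked by pairing with complex
Gaussians, which determine a function and on which every operator acts explicitly. -/

/-! ### Complex Gaussians: Schwartz decay and Fourier transforms. -/

lemma norm_iteratedFDeriv_cexp_le (i : ℕ) (z : ℂ) :
    ‖iteratedFDeriv ℝ i Complex.exp z‖ ≤ Real.exp z.re := by
  rw [← (Complex.contDiff_exp (𝕜 := ℂ) (n := i)).contDiffAt.restrictScalars_iteratedFDeriv (𝕜 := ℝ)]
  simp only [Function.comp_apply, ContinuousMultilinearMap.norm_restrictScalars]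
  rw [norm_iteratedFDeriv_eq_norm_iteratedDeriv, iteratedDeriv_eq_iterate, Complex.iter_deriv_exp,
    Complex.norm_exp]

/-- The complex Gaussian `exp (-c |x|² + b · x)`. -/
noncomputable def gaussFn {n : ℕ} (c : ℂ) (b : Fin n → ℂ) (x : EuclideanSpace ℝ (Fin n)) : ℂ :=
  Complex.exp (-c * ‖x‖ ^ 2 + ∑ i, b i * x i)

section

variable {n : ℕ} (c : ℂ) (b : Fin n → ℂ)

lemma hasTemperateGrowth_gaussExponent :
    Function.HasTemperateGrowth
      (fun x : EuclideanSpace ℝ (Fin n) => -c * ((‖x‖ : ℂ)) ^ 2 + ∑ i, b i * (x i : ℂ)) := by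
  have h1 : Function.HasTemperateGrowth
      (fun x : EuclideanSpace ℝ (Fin n) => ((‖x‖ : ℂ)) ^ 2) := by
    have := Function.HasTemperateGrowth.comp Function.Complex.hasTemperateGrowth_ofReal
      (Function.hasTemperateGrowth_norm_sq (H := EuclideanSpace ℝ (Fin n)))
    simpa [Function.comp_def] using this
  have h2 : ∀ i, Function.HasTemperateGrowth
      (fun x : EuclideanSpace ℝ (Fin n) => (x i : ℂ)) := fun i =>
    Function.HasTemperateGrowth.comp Function.Complex.hasTemperateGrowth_ofReal
      (EuclideanSpace.proj (𝕜 := ℝ) i).hasTemperateGrowth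
  exact ((Function.HasTemperateGrowth.const _).mul h1).add
    (.sum fun i _ => (Function.HasTemperateGrowth.const _).mul (h2 i))

lemma contDiff_gaussFn {m : WithTop ℕ∞} (hm : m ≤ (⊤ : ℕ∞)) : ContDiff ℝ m (gaussFn c b) :=
  ((Complex.contDiff_exp (𝕜 := ℝ)).comp (hasTemperateGrowth_gaussExponent c b).1).of_le hm

lemma norm_gaussFn (x : EuclideanSpace ℝ (Fin n)) :
    ‖gaussFn c b x‖ = Real.exp (-c.re * ‖x‖ ^ 2 + ∑ i, (b i).re * x i) := by
  rw [gaussFn, Complex.norm_exp]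
  congr 1
  simp only [Complex.add_re, Complex.re_sum, Complex.mul_re, Complex.ofReal_re, Complex.ofReal_im,
    mul_zero, sub_zero, Complex.neg_re]
  norm_cast
  simp

lemma norm_gaussFn_le (x : EuclideanSpace ℝ (Fin n)) :
    ‖gaussFn c b x‖ ≤ Real.exp (-c.re * ‖x‖ ^ 2 + (∑ i, |(b i).re|) * ‖x‖) := by
  rw [norm_gaussFn, Finset.sum_mul]
  refine Real.exp_le_exp.mpr (add_le_add_right (Finset.sum_le_sum fun i _ => ?_) _)
  calc (b i).re * x i ≤ |(b i).re * x i| := le_abs_self _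
    _ ≤ |(b i).re| * ‖x‖ := by
      rw [abs_mul]
      gcongr
      exact PiLp.norm_apply_le x i

lemma norm_iteratedFDeriv_gaussFn_le (N : ℕ) : ∃ (k : ℕ) (K : ℝ), 0 ≤ K ∧
    ∀ x : EuclideanSpace ℝ (Fin n), ‖iteratedFDeriv ℝ N (gaussFn c b) x‖
      ≤ K * ‖gaussFn c b x‖ * (1 + ‖x‖) ^ k := by
  have hq := hasTemperateGrowth_gaussExponent c b
  obtain ⟨k, C, hC, h⟩ := hq.norm_iteratedFDeriv_le_uniform N
  refine ⟨k * N, N.factorial * (1 + C) ^ N, by positivity, fun x => ?_⟩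
  -- The composition bound asks for `D ^ i` in order `i`, whereas temperate growth gives one bound
  -- for all orders; a base `D ≥ 1` reconciles them.
  have hD1 : 1 ≤ (1 + C) * (1 + ‖x‖) ^ k := by
    have : 1 ≤ (1 + ‖x‖) ^ k := one_le_pow₀ (by linarith [norm_nonneg x])
    nlinarith
  have := norm_iteratedFDeriv_comp_le (𝕜 := ℝ) (n := N) (N := (⊤ : ℕ∞))
    (Complex.contDiff_exp (𝕜 := ℝ)) hq.1 (by exact_mod_cast le_top) x (C := ‖gaussFn c b x‖)
    (D := (1 + C) * (1 + ‖x‖) ^ k)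
    (fun i _ => (norm_iteratedFDeriv_cexp_le i _).trans (by rw [gaussFn, Complex.norm_exp]))
    (fun i hi hiN => (h i hiN x).trans <| by
      calc C * (1 + ‖x‖) ^ k ≤ (1 + C) * (1 + ‖x‖) ^ k := by gcongr; linarith
        _ ≤ _ := le_self_pow₀ hD1 (by omega))
  refine this.trans (le_of_eq ?_)
  rw [mul_pow, ← pow_mul]
  ring

lemma decay_gaussFn (hc : 0 < c.re) (k N : ℕ) : ∃ C : ℝ, ∀ x : EuclideanSpace ℝ (Fin n),
    ‖x‖ ^ k * ‖iteratedFDeriv ℝ N (gaussFn c b) x‖ ≤ C := by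
  obtain ⟨m, K, hK, h⟩ := norm_iteratedFDeriv_gaussFn_le c b N
  set M := ∑ i, |(b i).re|
  refine ⟨K * ((k + m).factorial * Real.exp (1 + (M + 1) ^ 2 / (4 * c.re))), fun x => ?_⟩
  have hx := norm_nonneg x
  calc ‖x‖ ^ k * ‖iteratedFDeriv ℝ N (gaussFn c b) x‖
      ≤ (1 + ‖x‖) ^ k * (K * ‖gaussFn c b x‖ * (1 + ‖x‖) ^ m) := by
        gcongr
        · linarith
        · exact h x
    _ = K * ((1 + ‖x‖) ^ (k + m) * ‖gaussFn c b x‖) := by ring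
    _ ≤ K * (((k + m).factorial * Real.exp (1 + ‖x‖)) *
          Real.exp (-c.re * ‖x‖ ^ 2 + M * ‖x‖)) := by
        gcongr
        · have := Real.pow_div_factorial_le_exp (1 + ‖x‖) (by positivity) (k + m)
          rwa [div_le_iff₀' (by positivity)] at this
        · exact norm_gaussFn_le c b x
    _ ≤ _ := by
        rw [mul_assoc (_ : ℝ) (Real.exp _), ← Real.exp_add]
        refine mul_le_mul_of_nonneg_left (mul_le_mul_of_nonneg_left
          (Real.exp_le_exp.mpr ?_) (by positivity)) hK
        -- Completing the square absorbs the linear term `(M + 1)‖x‖`, whose extra `1` comes from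
        -- bounding the polynomial by `exp (1 + ‖x‖)`.
        have : 0 ≤ (2 * c.re * ‖x‖ - (M + 1)) ^ 2 / (4 * c.re) := by positivity
        have e : (2 * c.re * ‖x‖ - (M + 1)) ^ 2 / (4 * c.re)
          = c.re * ‖x‖ ^ 2 - (M + 1) * ‖x‖ + (M + 1) ^ 2 / (4 * c.re) := by
          field_simp
          ring
        linarith

/-- The complex Gaussian as a Schwartz function. -/
noncomputable def gaussSchwartz (hc : 0 < c.re) : 𝓢(EuclideanSpace ℝ (Fin n), ℂ) where
  toFun := gaussFn c b
  smooth' := contDiff_gaussFn c b le_rfl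
  decay' := decay_gaussFn c b hc

@[simp] lemma gaussSchwartz_apply (hc : 0 < c.re) (x : EuclideanSpace ℝ (Fin n)) :
    gaussSchwartz c b hc x = gaussFn c b x := rfl

lemma integral_gaussFn (hc : 0 < c.re) :
    ∫ x, gaussFn c b x
      = (Real.pi / c) ^ ((n : ℂ) / 2) * Complex.exp ((∑ i, b i ^ 2) / (4 * c)) := by
  have := GaussianFourier.integral_cexp_neg_mul_sum_add hc b
  rw [Fintype.card_fin] at this
  rw [← this, ← (EuclideanSpace.volume_preserving_symm_measurableEquiv_toLp
    (Fin n)).symm.integral_comp (MeasurableEquiv.measurableEmbedding _)]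
  congr 1
  ext x
  rw [gaussFn]
  congr 2
  rw [← Complex.ofReal_pow, EuclideanSpace.norm_sq_eq]
  simp

/-- The constant `(π / c) ^ (n / 2) * exp (b · b / 4 c)` in the Fourier transform of a Gaussian. -/
noncomputable def gaussConst {n : ℕ} (c : ℂ) (b : Fin n → ℂ) : ℂ :=
  (Real.pi / c) ^ ((n : ℂ) / 2) * Complex.exp ((∑ i, b i ^ 2) / (4 * c))

lemma fourier_gaussFn (hc : 0 < c.re) (ξ : EuclideanSpace ℝ (Fin n)) :
    𝓕 (gaussFn c b) ξ = gaussConst c b *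
      gaussFn (Real.pi ^ 2 / c) (fun i => -Complex.I * Real.pi * b i / c) ξ := by
  have hc0 : c ≠ 0 := fun h => by simp [h] at hc
  rw [Real.fourier_eq']
  have : ∀ v : EuclideanSpace ℝ (Fin n),
      Complex.exp (↑(-2 * Real.pi * inner ℝ v ξ) * Complex.I) • gaussFn c b v
        = gaussFn c (fun i => b i - 2 * Real.pi * Complex.I * ξ i) v := by
    intro v
    rw [gaussFn, gaussFn, smul_eq_mul, ← Complex.exp_add]
    congr 1
    simp only [PiLp.inner_apply, RCLike.inner_apply, conj_trivial]
    push_cast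
    rw [Finset.mul_sum, Finset.sum_mul, add_left_comm, ← Finset.sum_add_distrib]
    congr 1
    exact Finset.sum_congr rfl fun i _ => by ring
  have hs : (∑ i, (b i - 2 * Real.pi * Complex.I * ξ i) ^ 2) / (4 * c)
      = (∑ i, b i ^ 2) / (4 * c) + (-(Real.pi ^ 2 / c) * ‖ξ‖ ^ 2
        + ∑ i, -Complex.I * Real.pi * b i / c * ξ i) := by
    rw [← Complex.ofReal_pow ‖ξ‖, EuclideanSpace.norm_sq_eq]
    simp only [Real.norm_eq_abs, sq_abs]
    push_cast
    rw [Finset.mul_sum, Finset.sum_div, Finset.sum_div, ← Finset.sum_add_distrib,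
      ← Finset.sum_add_distrib]
    refine Finset.sum_congr rfl fun i _ => ?_
    field_simp
    ring_nf
    simp only [Complex.I_sq]
    ring
  simp_rw [this]
  rw [integral_gaussFn _ _ hc, hs, Complex.exp_add, gaussConst, gaussFn, mul_assoc]

/-! ### Gaussian pairings and their behaviour under weights, chirps and `𝓕`. -/

/-- An integrable function with vanishing Fourier transform vanishes almost everywhere. -/
lemma ae_eq_zero_of_fourier_eq_zero {H : EuclideanSpace ℝ (Fin n) → ℂ} (hH : Integrable H)
    (h : ∀ ξ, 𝓕 H ξ = 0) : H =ᵐ[volume] 0 := by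
  refine ae_eq_zero_of_integral_contDiff_smul_eq_zero hH.locallyIntegrable fun g hg hgc => ?_
  have hg₁ : HasCompactSupport (Complex.ofRealCLM ∘ g) := hgc.comp_left rfl
  have hg₂ : ContDiff ℝ (⊤ : ℕ∞) (Complex.ofRealCLM ∘ g) := by fun_prop
  set φ : 𝓢(EuclideanSpace ℝ (Fin n), ℂ) := hg₁.toSchwartzMap hg₂
  set ψ : 𝓢(EuclideanSpace ℝ (Fin n), ℂ) := 𝓕⁻ φ with hψ
  have hint : Integrable ψ (volume : Measure (EuclideanSpace ℝ (Fin n))) := ψ.integrable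
  -- Every test function is the Fourier transform of a Schwartz function, so the transform can be
  -- moved onto `H`.
  have key : ∫ ξ, 𝓕 H ξ * ψ ξ = ∫ x, H x * (𝓕 ψ) x := by
    simpa using! VectorFourier.integral_bilin_fourierIntegral_eq_flip (.mul ℂ ℂ)
      (L := innerₗ (EuclideanSpace ℝ (Fin n)))
      Real.continuous_fourierChar continuous_inner hH hint
  rw [hψ, FourierTransform.fourier_fourierInv_eq] at key
  simp only [h, zero_mul, integral_zero] at key
  rw [key]
  refine integral_congr_ae (.of_forall fun x => ?_)
  simp [φ, mul_comm]

/-- `f` is integrable against every complex Gaussian. -/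
def GaussIntegrable (f : EuclideanSpace ℝ (Fin n) → ℂ) : Prop :=
  ∀ (c : ℂ) (b : Fin n → ℂ), 0 < c.re → Integrable (fun x => f x * gaussFn c b x)

/-- The pairing of `f` with the complex Gaussian `gaussFn c b`. -/
noncomputable def gaussTransform (f : EuclideanSpace ℝ (Fin n) → ℂ) (c : ℂ) (b : Fin n → ℂ) : ℂ :=
  ∫ x, f x * gaussFn c b x

/-- Multiplication by `exp (ν · x)`. -/
noncomputable def expLin (ν : EuclideanSpace ℝ (Fin n)) (f : EuclideanSpace ℝ (Fin n) → ℂ)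
    (x : EuclideanSpace ℝ (Fin n)) : ℂ :=
  (Real.exp (inner ℝ ν x) : ℂ) * f x

/-- Multiplication by the chirp `exp (i k |x|²)`. -/
noncomputable def chirp (k : ℝ) (f : EuclideanSpace ℝ (Fin n) → ℂ)
    (x : EuclideanSpace ℝ (Fin n)) : ℂ :=
  Complex.exp (Complex.I * k * ‖x‖ ^ 2) * f x

lemma _root_.MeasureTheory.MemLp.gaussIntegrable {f : EuclideanSpace ℝ (Fin n) → ℂ}
    (hf : MemLp f 2) : GaussIntegrable f := fun c b hc =>
  hf.integrable_mul (q := 2) (show MemLp (gaussFn c b) 2 volume from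
    (gaussSchwartz c b hc).memLp 2 volume)

lemma expLin_mul_gaussFn (ν : EuclideanSpace ℝ (Fin n)) (f : EuclideanSpace ℝ (Fin n) → ℂ)
    (c : ℂ) (b : Fin n → ℂ) (x : EuclideanSpace ℝ (Fin n)) :
    expLin ν f x * gaussFn c b x = f x * gaussFn c (fun i => b i + ν i) x := by
  rw [expLin, gaussFn, gaussFn, mul_comm (Complex.ofReal _), mul_assoc, Complex.ofReal_exp,
    ← Complex.exp_add]
  congr 2
  simp only [PiLp.inner_apply, RCLike.inner_apply, conj_trivial, add_mul, Finset.sum_add_distrib]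
  push_cast
  simp only [mul_comm]
  ring

lemma chirp_mul_gaussFn (k : ℝ) (f : EuclideanSpace ℝ (Fin n) → ℂ)
    (c : ℂ) (b : Fin n → ℂ) (x : EuclideanSpace ℝ (Fin n)) :
    chirp k f x * gaussFn c b x = f x * gaussFn (c - Complex.I * k) b x := by
  rw [chirp, gaussFn, gaussFn, mul_comm (Complex.exp _), mul_assoc, ← Complex.exp_add]
  congr 2
  ring

lemma gaussTransform_expLin (ν : EuclideanSpace ℝ (Fin n)) (f : EuclideanSpace ℝ (Fin n) → ℂ)
    (c : ℂ) (b : Fin n → ℂ) :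
    gaussTransform (expLin ν f) c b = gaussTransform f c (fun i => b i + ν i) := by
  simp_rw [gaussTransform, expLin_mul_gaussFn]

lemma gaussTransform_chirp (k : ℝ) (f : EuclideanSpace ℝ (Fin n) → ℂ)
    (c : ℂ) (b : Fin n → ℂ) :
    gaussTransform (chirp k f) c b = gaussTransform f (c - Complex.I * k) b := by
  simp_rw [gaussTransform, chirp_mul_gaussFn]

lemma GaussIntegrable.expLin {f : EuclideanSpace ℝ (Fin n) → ℂ} (hf : GaussIntegrable f)
    (ν : EuclideanSpace ℝ (Fin n)) : GaussIntegrable (expLin ν f) := fun c b hc => by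
  simp_rw [expLin_mul_gaussFn]
  exact hf _ _ hc

lemma gaussTransform_congr {f g : EuclideanSpace ℝ (Fin n) → ℂ} (h : f =ᵐ[volume] g)
    (c : ℂ) (b : Fin n → ℂ) : gaussTransform f c b = gaussTransform g c b :=
  integral_congr_ae (h.mono fun x hx => by simp [hx])

lemma expLin_congr {f g : EuclideanSpace ℝ (Fin n) → ℂ} (h : f =ᵐ[volume] g)
    (ν : EuclideanSpace ℝ (Fin n)) : expLin ν f =ᵐ[volume] expLin ν g :=
  h.mono fun x hx => by simp [expLin, hx]

lemma chirp_congr {f g : EuclideanSpace ℝ (Fin n) → ℂ} (h : f =ᵐ[volume] g)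
    (k : ℝ) : chirp k f =ᵐ[volume] chirp k g :=
  h.mono fun x hx => by simp [chirp, hx]

lemma norm_chirp (k : ℝ) (f : EuclideanSpace ℝ (Fin n) → ℂ) (x : EuclideanSpace ℝ (Fin n)) :
    ‖chirp k f x‖ = ‖f x‖ := by
  rw [chirp, norm_mul, Complex.norm_exp]
  have : (Complex.I * k * (‖x‖ : ℂ) ^ 2).re = 0 := by
    rw [← Complex.ofReal_pow, mul_assoc, ← Complex.ofReal_mul, Complex.I_mul_re,
      Complex.ofReal_im, neg_zero]
  simp [this]

lemma chirp_chirp (k l : ℝ) (f : EuclideanSpace ℝ (Fin n) → ℂ) :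
    chirp k (chirp l f) = chirp (k + l) f := by
  ext x
  simp only [chirp]
  rw [← mul_assoc, ← Complex.exp_add]
  congr 2
  push_cast
  ring

lemma chirp_zero (f : EuclideanSpace ℝ (Fin n) → ℂ) : chirp 0 f = f := by
  ext x
  simp [chirp]

lemma expLin_chirp (ν : EuclideanSpace ℝ (Fin n)) (k : ℝ) (f : EuclideanSpace ℝ (Fin n) → ℂ) :
    expLin ν (chirp k f) = chirp k (expLin ν f) := by
  ext x
  simp only [chirp, expLin]
  ring

lemma expLin_expLin (ν ν' : EuclideanSpace ℝ (Fin n)) (f : EuclideanSpace ℝ (Fin n) → ℂ) :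
    expLin ν (expLin ν' f) = expLin (ν + ν') f := by
  ext x
  simp only [expLin]
  rw [← mul_assoc, ← Complex.ofReal_mul, ← Real.exp_add, inner_add_left]

lemma expLin_zero (f : EuclideanSpace ℝ (Fin n) → ℂ) : expLin 0 f = f := by
  ext x
  simp [expLin]

lemma aestronglyMeasurable_chirp {f : EuclideanSpace ℝ (Fin n) → ℂ}
    (hf : AEStronglyMeasurable f volume) (k : ℝ) : AEStronglyMeasurable (chirp k f) volume := by
  have : Continuous fun x : EuclideanSpace ℝ (Fin n) =>
    Complex.exp (Complex.I * k * (‖x‖ : ℂ) ^ 2) := by fun_prop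
  exact this.aestronglyMeasurable.mul hf

lemma aestronglyMeasurable_expLin {f : EuclideanSpace ℝ (Fin n) → ℂ}
    (hf : AEStronglyMeasurable f volume) (ν : EuclideanSpace ℝ (Fin n)) :
    AEStronglyMeasurable (expLin ν f) volume := by
  have : Continuous fun x : EuclideanSpace ℝ (Fin n) =>
    (Real.exp (inner ℝ ν x) : ℂ) := by fun_prop
  exact this.aestronglyMeasurable.mul hf

lemma eLpNorm_chirp (k : ℝ) (f : EuclideanSpace ℝ (Fin n) → ℂ) :
    eLpNorm (chirp k f) 2 volume = eLpNorm f 2 volume :=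
  eLpNorm_congr_norm_ae (.of_forall fun x => norm_chirp k f x)

lemma memLp_chirp {f : EuclideanSpace ℝ (Fin n) → ℂ} (hf : MemLp f 2) (k : ℝ) :
    MemLp (chirp k f) 2 :=
  ⟨aestronglyMeasurable_chirp hf.1 k, by rw [eLpNorm_chirp]; exact hf.2⟩

/-- A function is determined by its pairings with the Gaussians `gaussFn c b` for a single `c`. -/
lemma ae_eq_of_gaussTransform_eq {f g : EuclideanSpace ℝ (Fin n) → ℂ} (hf : GaussIntegrable f)
    (hg : GaussIntegrable g) {c : ℂ} (hc : 0 < c.re) (κ : ℂ)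
    (h : ∀ b, gaussTransform f c b = κ * gaussTransform g c b) :
    f =ᵐ[volume] fun x => κ * g x := by
  -- Purely imaginary `b` turn the pairings into the Fourier transform of the integrable function
  -- `(f - κ g) · gaussFn c 0`; the Gaussian factor never vanishes.
  have hi : Integrable (fun x => f x * gaussFn c 0 x - κ * (g x * gaussFn c 0 x)) :=
    (hf c 0 hc).sub ((hg c 0 hc).const_mul κ)
  have hshift : ∀ (ξ x : EuclideanSpace ℝ (Fin n)),
      Complex.exp (↑(-2 * Real.pi * inner ℝ x ξ) * Complex.I) * gaussFn c 0 x
        = gaussFn c (fun i => -2 * Real.pi * Complex.I * ξ i) x := by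
    intro ξ x
    rw [gaussFn, gaussFn, ← Complex.exp_add]
    congr 1
    simp only [PiLp.inner_apply, RCLike.inner_apply, conj_trivial, Pi.zero_apply, zero_mul,
      Finset.sum_const_zero, add_zero]
    push_cast
    rw [Finset.mul_sum, Finset.sum_mul, add_comm]
    congr 1
    exact Finset.sum_congr rfl fun i _ => by ring
  have := ae_eq_zero_of_fourier_eq_zero hi fun ξ => by
    rw [Real.fourier_eq']
    have e : ∀ x : EuclideanSpace ℝ (Fin n),
        Complex.exp (↑(-2 * Real.pi * inner ℝ x ξ) * Complex.I) •
          (f x * gaussFn c 0 x - κ * (g x * gaussFn c 0 x))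
        = f x * gaussFn c (fun i => -2 * Real.pi * Complex.I * ξ i) x
          - κ * (g x * gaussFn c (fun i => -2 * Real.pi * Complex.I * ξ i) x) := by
      intro x
      rw [← hshift, smul_eq_mul]
      ring
    simp_rw [e]
    rw [integral_sub (hf _ _ hc) ((hg _ _ hc).const_mul κ), integral_const_mul, sub_eq_zero]
    exact h _
  filter_upwards [this] with x hx
  have h0 : gaussFn c 0 x ≠ 0 := Complex.exp_ne_zero _
  have : (f x - κ * g x) * gaussFn c 0 x = 0 := by
    simpa [sub_mul, mul_assoc] using hx
  simpa [h0, sub_eq_zero] using this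

/-- Parseval's identity for `L²` functions against Schwartz functions. -/
lemma integral_fourier_mul (q : L2 n) (φ : 𝓢(EuclideanSpace ℝ (Fin n), ℂ)) :
    ∫ x, (𝓕 q : L2 n) x * φ x = ∫ x, q x * 𝓕 φ x := by
  have := congrArg (fun T => T φ) (Lp.fourier_toTemperedDistribution_eq q)
  simp only [TemperedDistribution.fourier_apply, Lp.toTemperedDistribution_apply,
    smul_eq_mul] at this
  simp_rw [mul_comm _ (φ _), mul_comm _ (𝓕 φ _)]
  exact this.symm

lemma pi_sq_div_re_pos {c : ℂ} (hc : 0 < c.re) : 0 < ((Real.pi : ℂ) ^ 2 / c).re := by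
  rw [← Complex.ofReal_pow, div_eq_mul_inv, Complex.re_ofReal_mul, Complex.inv_re]
  have hc0 : c ≠ 0 := fun h => by simp [h] at hc
  have := Complex.normSq_pos.mpr hc0
  positivity

lemma gaussTransform_fourier (q : L2 n) {c : ℂ} (hc : 0 < c.re) (b : Fin n → ℂ) :
    gaussTransform (𝓕 q : L2 n) c b = gaussConst c b *
      gaussTransform q (Real.pi ^ 2 / c) (fun i => -Complex.I * Real.pi * b i / c) := by
  have := integral_fourier_mul q (gaussSchwartz c b hc)
  simp only [gaussSchwartz_apply, SchwartzMap.fourier_coe] at this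
  rw [gaussTransform, this, gaussTransform, ← integral_const_mul]
  congr 1
  ext x
  have e : 𝓕 (⇑(gaussSchwartz c b hc)) x = 𝓕 (gaussFn c b) x := rfl
  rw [e, fourier_gaussFn _ _ hc]
  ring

/-! ### The equation on the Fourier side. -/

/-- The product rule for a continuous bilinear pairing of a continuous path `w`, differentiable
only when paired with `Φ s`, and a differentiable path `Φ`. -/
lemma hasDerivAt_pairing {E F G : Type*} [NormedAddCommGroup E] [NormedSpace ℝ E]
    [NormedAddCommGroup F] [NormedSpace ℝ F] [NormedAddCommGroup G] [NormedSpace ℝ G]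
    (B : E →L[ℝ] F →L[ℝ] G) {w : ℝ → E} {Φ : ℝ → F} {Φ' : F} {d : G} {s : ℝ}
    (hw : ContinuousAt w s) (hΦ : HasDerivAt Φ Φ' s)
    (hd : HasDerivAt (fun r => B (w r) (Φ s)) d s) :
    HasDerivAt (fun r => B (w r) (Φ r)) (d + B (w s) Φ') s := by
  rw [hasDerivAt_iff_tendsto_slope] at hΦ hd ⊢
  have h1 : Filter.Tendsto (fun r => B (w r) (slope Φ s r)) (nhdsWithin s {s}ᶜ)
      (nhds (B (w s) Φ')) :=
    B.isBoundedBilinearMap.continuous.continuousAt.tendsto.comp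
      ((hw.tendsto.mono_left nhdsWithin_le_nhds).prodMk_nhds hΦ)
  -- The slope splits into the slope with `Φ` frozen at `s` and `B (w r)` applied to the slope of
  -- `Φ`; thus `w` need only be continuous.
  refine (hd.add h1).congr fun r => ?_
  simp only [slope_def_module, map_smul, map_sub]
  rw [← smul_add]
  congr 1
  abel

lemma continuousOn_pairing {E F G : Type*} [NormedAddCommGroup E] [NormedSpace ℝ E]
    [NormedAddCommGroup F] [NormedSpace ℝ F] [NormedAddCommGroup G] [NormedSpace ℝ G]
    (B : E →L[ℝ] F →L[ℝ] G) {w : ℝ → E} {Φ : ℝ → F} {s : Set ℝ}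
    (hw : ContinuousOn w s) (hΦ : ContinuousOn Φ s) :
    ContinuousOn (fun r => B (w r) (Φ r)) s :=
  (B.continuous.comp_continuousOn hw).clm_apply hΦ

/-- A Taylor remainder bound valid for all real `x`, as needed with `x = h|y|²` and `y` unbounded:
Taylor for `|x| ≤ 1`, the triangle inequality beyond. -/
lemma norm_exp_I_mul_sub_one_sub_le (x : ℝ) :
    ‖Complex.exp (Complex.I * x) - 1 - Complex.I * x‖ ≤ 2 * x ^ 2 := by
  have hn : ‖Complex.I * (x : ℂ)‖ = |x| := by simp
  rcases le_total |x| 1 with h | h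
  · have := Complex.norm_exp_sub_one_sub_id_le (x := Complex.I * x) (by rwa [hn])
    rw [hn, sq_abs] at this
    nlinarith [sq_nonneg x]
  · calc _ ≤ ‖Complex.exp (Complex.I * x) - 1‖ + ‖Complex.I * x‖ := norm_sub_le _ _
      _ ≤ |x| + |x| := by
        rw [hn]
        gcongr
        exact Real.norm_exp_I_mul_ofReal_sub_one_le
      _ ≤ 2 * x ^ 2 := by rw [← sq_abs]; nlinarith

lemma sub_I_mul_re_pos {c : ℂ} (hc : 0 < c.re) (s : ℝ) : 0 < (c - Complex.I * s).re := by
  simpa using hc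

lemma gaussFn_sub_I_mul (c : ℂ) (b : Fin n → ℂ) (s : ℝ) (x : EuclideanSpace ℝ (Fin n)) :
    gaussFn (c - Complex.I * s) b x = Complex.exp (Complex.I * (s * ‖x‖ ^ 2 : ℝ)) * gaussFn c b x := by
  rw [gaussFn, gaussFn, ← Complex.exp_add]
  congr 1
  push_cast
  ring

/-- Multiplication of a Schwartz function by `|x|²`. -/
noncomputable def normSqSchwartz (φ : 𝓢(EuclideanSpace ℝ (Fin n), ℂ)) :
    𝓢(EuclideanSpace ℝ (Fin n), ℂ) :=
  SchwartzMap.smulLeftCLM ℂ ((‖·‖ ^ 2) : EuclideanSpace ℝ (Fin n) → ℝ) φ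

lemma normSqSchwartz_apply (φ : 𝓢(EuclideanSpace ℝ (Fin n), ℂ)) (x : EuclideanSpace ℝ (Fin n)) :
    normSqSchwartz φ x = (‖x‖ : ℂ) ^ 2 * φ x := by
  rw [normSqSchwartz, SchwartzMap.smulLeftCLM_apply_apply (g := fun x => ‖x‖ ^ 2)
    (Function.hasTemperateGrowth_norm_sq (EuclideanSpace ℝ (Fin n)))]
  simp

lemma laplacian_fourierInv (φ : 𝓢(EuclideanSpace ℝ (Fin n), ℂ)) :
    Δ (𝓕⁻ φ) = -(2 * Real.pi) ^ 2 • 𝓕⁻ (normSqSchwartz φ) := by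
  rw [SchwartzMap.laplacian_eq_fourierMultiplierCLM, SchwartzMap.fourierMultiplierCLM_apply,
    FourierTransform.fourier_fourierInv_eq]
  rfl

/-- Parseval's identity for the inverse Fourier transform. -/
lemma integral_fourierInv_mul (q : L2 n) (φ : 𝓢(EuclideanSpace ℝ (Fin n), ℂ)) :
    ∫ x, (𝓕⁻ q : L2 n) x * φ x = ∫ x, q x * (𝓕⁻ φ) x := by
  have := integral_fourier_mul (𝓕⁻ q) (𝓕⁻ φ)
  rw [FourierTransform.fourier_fourierInv_eq] at this
  rw [this]
  have h : (𝓕 (𝓕⁻ φ) : 𝓢(EuclideanSpace ℝ (Fin n), ℂ)) = φ :=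
    FourierTransform.fourier_fourierInv_eq φ
  simp only [h]

/-- The path of modulated Gaussians `exp (i s |x|²) gaussFn c b` in `L²`. -/
noncomputable def gaussPath (c : ℂ) (b : Fin n → ℂ) (hc : 0 < c.re) (s : ℝ) : L2 n :=
  (gaussSchwartz (c - Complex.I * s) b (sub_I_mul_re_pos hc s)).toLp 2

lemma hasDerivAt_gaussPath (c : ℂ) (b : Fin n → ℂ) (hc : 0 < c.re) (s : ℝ) :
    HasDerivAt (gaussPath c b hc) (Complex.I •
      (normSqSchwartz (gaussSchwartz (c - Complex.I * s) b (sub_I_mul_re_pos hc s))).toLp 2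
        volume) s := by
  set φ := gaussSchwartz (c - Complex.I * s) b (sub_I_mul_re_pos hc s) with hφ
  set Q : L2 n := (normSqSchwartz (normSqSchwartz φ)).toLp 2 with hQ
  rw [hasDerivAt_iff_isLittleO_nhds_zero]
  have hO : (fun h : ℝ => gaussPath c b hc (s + h) - gaussPath c b hc s -
      h • (Complex.I • (normSqSchwartz φ).toLp 2 volume : L2 n)) =O[nhds 0]
      fun h : ℝ => h ^ 2 := by
    -- The pointwise remainder is at most `2 h² |x|⁴ |φ|`, and `Q` is `|x|⁴ φ`.
    refine Asymptotics.IsBigO.of_bound (2 * ‖Q‖) (.of_forall fun h => ?_)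
    have : ‖gaussPath c b hc (s + h) - gaussPath c b hc s -
      h • (Complex.I • (normSqSchwartz φ).toLp 2 volume : L2 n)‖ ≤ (2 * h ^ 2) * ‖Q‖ := by
      refine Lp.norm_le_mul_norm_of_ae_le_mul ?_
      filter_upwards [Lp.coeFn_sub (gaussPath c b hc (s + h) - gaussPath c b hc s)
        (h • (Complex.I • (normSqSchwartz φ).toLp 2 volume : L2 n)),
        Lp.coeFn_sub (gaussPath c b hc (s + h)) (gaussPath c b hc s),
        Lp.coeFn_smul h (Complex.I • (normSqSchwartz φ).toLp 2 volume : L2 n),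
        Lp.coeFn_smul Complex.I ((normSqSchwartz φ).toLp 2 volume : L2 n),
        (normSqSchwartz φ).coeFn_toLp 2 volume,
        (normSqSchwartz (normSqSchwartz φ)).coeFn_toLp 2 volume,
        φ.coeFn_toLp 2 volume,
        (gaussSchwartz (c - Complex.I * ↑(s + h)) b
          (sub_I_mul_re_pos hc (s + h))).coeFn_toLp 2 volume]
        with x h1 h2 h3 h4 h5 h6 h7 h8
      have h7' : (gaussPath c b hc s) x = φ x := h7
      have h8' : (gaussPath c b hc (s + h)) x = gaussFn (c - Complex.I * ↑(s + h)) b x := h8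
      rw [h1, Pi.sub_apply, h2, Pi.sub_apply, h3, Pi.smul_apply, h4, Pi.smul_apply, h5, h6,
        h7', h8']
      simp only [normSqSchwartz_apply, hφ, gaussSchwartz_apply]
      have e : c - Complex.I * ↑(s + h) = (c - Complex.I * s) - Complex.I * h := by
        push_cast
        ring
      rw [e, gaussFn_sub_I_mul _ _ h]
      have e2 : Complex.exp (Complex.I * (h * ‖x‖ ^ 2 : ℝ)) * gaussFn (c - Complex.I * s) b x
          - gaussFn (c - Complex.I * s) b x
          - h • Complex.I • ((‖x‖ : ℂ) ^ 2 * gaussFn (c - Complex.I * s) b x)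
          = (Complex.exp (Complex.I * (h * ‖x‖ ^ 2 : ℝ)) - 1 - Complex.I * (h * ‖x‖ ^ 2 : ℝ))
            * gaussFn (c - Complex.I * s) b x := by
        rw [Complex.real_smul, smul_eq_mul]
        push_cast
        ring
      rw [e2, norm_mul, norm_mul, norm_mul]
      refine (mul_le_mul_of_nonneg_right (norm_exp_I_mul_sub_one_sub_le _)
        (norm_nonneg _)).trans (le_of_eq ?_)
      simp only [norm_pow, Complex.norm_real, norm_norm]
      ring
    refine this.trans (le_of_eq ?_)
    rw [norm_pow, Real.norm_eq_abs, sq_abs]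
    ring
  refine hO.trans_isLittleO ?_
  simpa using Asymptotics.isLittleO_pow_id (𝕜 := ℝ) (n := 2) (by norm_num)

/-- The pairing `∫ f g` on `L²`. -/
noncomputable def l2Pairing (n : ℕ) : L2 n →L[ℝ] L2 n →L[ℝ] ℂ :=
  (ContinuousLinearMap.mul ℝ ℂ).lpPairing volume 2 2

lemma l2Pairing_apply (f g : L2 n) : l2Pairing n f g = ∫ x, f x * g x := by
  rw [l2Pairing, ContinuousLinearMap.lpPairing_eq_integral]
  rfl

lemma l2Pairing_toLp (f : L2 n) (φ : 𝓢(EuclideanSpace ℝ (Fin n), ℂ)) :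
    l2Pairing n f (φ.toLp 2) = ∫ x, f x * φ x := by
  rw [l2Pairing_apply]
  refine integral_congr_ae ((φ.coeFn_toLp 2 volume).mono fun x hx => ?_)
  simp only [hx]

lemma l2Pairing_smul_right (f g : L2 n) (z : ℂ) :
    l2Pairing n f (z • g) = z * l2Pairing n f g := by
  rw [l2Pairing_apply, l2Pairing_apply, ← integral_const_mul]
  refine integral_congr_ae ((Lp.coeFn_smul z g).mono fun x hx => ?_)
  simp only [hx, Pi.smul_apply, smul_eq_mul]
  ring

namespace IsFreeSchrodingerSolution

variable {u₀ : L2 n} {u : ℝ → L2 n}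

lemma continuousOn_fourierInv (hu : IsFreeSchrodingerSolution u₀ u) :
    ContinuousOn (fun s => (𝓕⁻ (u s) : L2 n)) (Ici 0) :=
  (Lp.fourierTransformₗᵢ (EuclideanSpace ℝ (Fin n)) ℂ).symm.continuous.comp_continuousOn
    hu.continuousOn

/-- The equation on the Fourier side. -/
lemma hasDerivAt_fourierInv (hu : IsFreeSchrodingerSolution u₀ u)
    (φ : 𝓢(EuclideanSpace ℝ (Fin n), ℂ)) {t : ℝ} (ht : 0 < t) :
    HasDerivAt (fun s => l2Pairing n (𝓕⁻ (u s)) (φ.toLp 2))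
      (-(2 * Real.pi) ^ 2 * Complex.I *
        l2Pairing n (𝓕⁻ (u t)) ((normSqSchwartz φ).toLp 2)) t := by
  simp_rw [l2Pairing_toLp, integral_fourierInv_mul]
  convert! hu.equation (𝓕⁻ φ) t ht using 1
  rw [laplacian_fourierInv, mul_comm _ Complex.I, mul_assoc, ← integral_const_mul]
  congr 2
  ext x
  rw [_root_.smul_apply, Complex.real_smul]
  push_cast
  ring

/-- The Gaussian pairings of the Fourier transform of the solution evolve by rotation of the
quadratic exponent. -/
lemma gaussTransform_fourierInv (hu : IsFreeSchrodingerSolution u₀ u) {t : ℝ} (ht : 0 ≤ t)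
    {c : ℂ} (hc : 0 < c.re) (b : Fin n → ℂ) :
    gaussTransform (𝓕⁻ (u t) : L2 n) c b =
      gaussTransform (𝓕⁻ u₀ : L2 n) (c + Complex.I * ((2 * Real.pi) ^ 2 * t : ℝ)) b := by
  set κ : ℝ := (2 * Real.pi) ^ 2 with hκ
  set c₀ : ℂ := c + Complex.I * (κ * t : ℝ) with hc₀
  have hc₀' : 0 < c₀.re := by
    rw [hc₀]
    simpa using hc
  -- The Gaussian rotates so that its derivative cancels the one coming from the equation; its
  -- quadratic coefficient is `c₀` at `s = 0` and `c` at `s = t`.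
  set F : ℝ → ℂ := fun s => l2Pairing n (𝓕⁻ (u s)) (gaussPath c₀ b hc₀' (κ * s)) with hF
  have hFG : ∀ s, F s = gaussTransform (𝓕⁻ (u s) : L2 n) (c₀ - Complex.I * (κ * s : ℝ)) b := by
    intro s
    simp only [hF, gaussPath]
    rw [l2Pairing_toLp]
    rfl
  have hpath : ∀ s, HasDerivAt (fun s => gaussPath c₀ b hc₀' (κ * s))
      (κ • (Complex.I • (normSqSchwartz (gaussSchwartz (c₀ - Complex.I * (κ * s : ℝ)) b
        (sub_I_mul_re_pos hc₀' (κ * s)))).toLp 2 volume : L2 n)) s := by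
    intro s
    have := (hasDerivAt_gaussPath c₀ b hc₀' (κ * s)).scomp s ((hasDerivAt_id s).const_mul κ)
    simpa [Function.comp_def] using this
  have hderiv : ∀ s, 0 < s → HasDerivAt F 0 s := by
    intro s hs
    have h := hasDerivAt_pairing (l2Pairing n)
      ((hu.continuousOn_fourierInv).continuousAt (Ici_mem_nhds hs)) (hpath s)
      (hu.hasDerivAt_fourierInv (gaussSchwartz (c₀ - Complex.I * (κ * s : ℝ)) b
        (sub_I_mul_re_pos hc₀' (κ * s))) hs)
    convert! h using 1
    rw [(l2Pairing n _).map_smul κ, l2Pairing_smul_right, Complex.real_smul, hκ]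
    push_cast
    ring
  have hcont : ContinuousOn F (Ici 0) := by
    have h2 : Continuous fun s => gaussPath c₀ b hc₀' (κ * s) :=
      continuous_iff_continuousAt.mpr fun s => (hpath s).continuousAt
    exact continuousOn_pairing (l2Pairing n) hu.continuousOn_fourierInv h2.continuousOn
  have hconst : F t = F 0 := by
    rcases ht.eq_or_lt with rfl | ht
    · rfl
    -- The equation holds only at positive times: `F` is constant on `[ε, t]`, and continuity at `0`
    -- gives the rest.
    have h1 : ∀ ε ∈ Ioc 0 t, F ε = F t := fun ε hε =>
      (constant_of_has_deriv_right_zero (hcont.mono fun x hx => hε.1.le.trans hx.1)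
        (fun x hx => (hderiv x (hε.1.trans_le hx.1)).hasDerivWithinAt) t ⟨hε.2, le_rfl⟩).symm
    have h2 : Filter.Tendsto F (nhdsWithin 0 (Ioi 0)) (nhds (F 0)) :=
      (hcont 0 self_mem_Ici).mono_left (nhdsWithin_mono _ Ioi_subset_Ici_self)
    have h3 : Filter.Tendsto F (nhdsWithin 0 (Ioi 0)) (nhds (F t)) :=
      tendsto_const_nhds.congr' (Filter.eventually_of_mem (Ioc_mem_nhdsGT ht)
        fun ε hε => (h1 ε hε).symm)
    exact tendsto_nhds_unique h3 h2
  rw [hFG, hFG, hu.initial] at hconst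
  simpa [hc₀] using hconst

end IsFreeSchrodingerSolution

/-! ### The solution as the Fourier transform of a chirped datum. -/

lemma measure_map_smul {r : ℝ} (hr : 0 < r) :
    Measure.map (r • · : EuclideanSpace ℝ (Fin n) → EuclideanSpace ℝ (Fin n)) volume
      = ENNReal.ofReal |(r ^ n)⁻¹| • (volume : Measure (EuclideanSpace ℝ (Fin n))) := by
  have := Measure.map_addHaar_smul (volume : Measure (EuclideanSpace ℝ (Fin n))) hr.ne'
  rwa [finrank_euclideanSpace_fin] at this

lemma eLpNorm_comp_smul {r : ℝ} (hr : 0 < r) (f : EuclideanSpace ℝ (Fin n) → ℂ) :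
    eLpNorm (fun x => f (r • x)) 2 volume
      = ENNReal.ofReal |(r ^ n)⁻¹| ^ (1 / (2 : ℝ)) * eLpNorm f 2 volume := by
  have hemb : MeasurableEmbedding (r • · : EuclideanSpace ℝ (Fin n) → EuclideanSpace ℝ (Fin n)) :=
    (Homeomorph.smulOfNeZero r hr.ne').measurableEmbedding
  have := hemb.eLpNorm_map_measure (g := f) (p := 2) (μ := volume)
  rw [measure_map_smul hr, eLpNorm_smul_measure_of_ne_top (by simp)] at this
  rw [← Function.comp_def f, ← this, smul_eq_mul]
  simp

lemma memLp_comp_smul {r : ℝ} (hr : 0 < r) {f : EuclideanSpace ℝ (Fin n) → ℂ}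
    (hf : MemLp f 2) : MemLp (fun x => f (r • x)) 2 := by
  have hq : Measure.QuasiMeasurePreserving
      (r • · : EuclideanSpace ℝ (Fin n) → EuclideanSpace ℝ (Fin n)) volume volume :=
    ⟨measurable_const_smul r, by
      rw [measure_map_smul hr]
      exact Measure.smul_absolutelyContinuous⟩
  refine ⟨hf.1.comp_quasiMeasurePreserving hq, ?_⟩
  rw [eLpNorm_comp_smul hr]
  exact ENNReal.mul_lt_top (ENNReal.rpow_lt_top_of_nonneg (by norm_num) ENNReal.ofReal_ne_top) hf.2

lemma gaussTransform_comp_smul {r : ℝ} (hr : 0 < r) (f : EuclideanSpace ℝ (Fin n) → ℂ)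
    (c : ℂ) (b : Fin n → ℂ) :
    gaussTransform (fun x => f (r • x)) c b
      = ((r ^ n)⁻¹ : ℝ) * gaussTransform f (c / r ^ 2) (fun i => b i / r) := by
  have hr' : (r : ℂ) ≠ 0 := by exact_mod_cast hr.ne'
  have e : ∀ x : EuclideanSpace ℝ (Fin n), f (r • x) * gaussFn c b x
      = (fun y => f y * gaussFn (c / r ^ 2) (fun i => b i / r) y) (r • x) := by
    intro x
    simp only [gaussFn, norm_smul, PiLp.smul_apply, smul_eq_mul, Real.norm_eq_abs, abs_of_pos hr]
    congr 2
    push_cast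
    congr 1
    · field_simp
    · exact Finset.sum_congr rfl fun i _ => by field_simp
  rw [gaussTransform]
  simp_rw [e]
  rw [Measure.integral_comp_smul volume
    (fun y => f y * gaussFn (c / r ^ 2) (fun i => b i / r) y), finrank_euclideanSpace_fin, gaussTransform, Complex.real_smul,
    abs_of_pos (by positivity)]

/-- The chirp multiplication on `L²`. -/
noncomputable def chirpLp (k : ℝ) (f : L2 n) : L2 n := (memLp_chirp (Lp.memLp f) k).toLp _

lemma coeFn_chirpLp (k : ℝ) (f : L2 n) : chirpLp k f =ᵐ[volume] chirp k f := MemLp.coeFn_toLp _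

lemma eLpNorm_coe_eq_enorm (f : L2 n) : eLpNorm f 2 volume = ‖f‖ₑ := (Lp.enorm_def f).symm

lemma enorm_fourier (f : L2 n) : ‖(𝓕 f : L2 n)‖ₑ = ‖f‖ₑ := by
  rw [← ofReal_norm, ← ofReal_norm, Lp.norm_fourier_eq]

lemma enorm_chirpLp (k : ℝ) (f : L2 n) : ‖chirpLp k f‖ₑ = ‖f‖ₑ := by
  rw [← eLpNorm_coe_eq_enorm, eLpNorm_congr_ae (coeFn_chirpLp k f), eLpNorm_chirp,
    eLpNorm_coe_eq_enorm]

/-- Isolates the dependence on `b`, so that the complex power is carried along as a nonzero constant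
and its branch never matters. -/
lemma gaussConst_eq (c : ℂ) (b : Fin n → ℂ) :
    gaussConst c b = gaussConst c (0 : Fin n → ℂ) * Complex.exp ((∑ i, b i ^ 2) / (4 * c)) := by
  simp [gaussConst]

lemma gaussConst_ne_zero {c : ℂ} (hc : 0 < c.re) (b : Fin n → ℂ) : gaussConst c b ≠ 0 := by
  have hc0 : c ≠ 0 := fun h => by simp [h] at hc
  refine mul_ne_zero (fun h => ?_) (Complex.exp_ne_zero _)
  rw [Complex.cpow_eq_zero_iff] at h
  exact div_ne_zero (by exact_mod_cast Real.pi_ne_zero) hc0 h.1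

namespace IsFreeSchrodingerSolution

variable {u₀ : L2 n} {u : ℝ → L2 n}

lemma fourierInv_ae_eq (hu : IsFreeSchrodingerSolution u₀ u) {t : ℝ} (ht : 0 ≤ t) :
    (𝓕⁻ (u t) : L2 n) =ᵐ[volume] chirp (-((2 * Real.pi) ^ 2 * t)) (𝓕⁻ u₀ : L2 n) := by
  have := ae_eq_of_gaussTransform_eq (f := (𝓕⁻ (u t) : L2 n))
    (g := chirp (-((2 * Real.pi) ^ 2 * t)) (𝓕⁻ u₀ : L2 n))
    (Lp.memLp _).gaussIntegrable (memLp_chirp (Lp.memLp _) _).gaussIntegrable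
    (c := 1) (by simp) 1 (fun b => by
      rw [hu.gaussTransform_fourierInv ht (by simp), gaussTransform_chirp, one_mul]
      congr 1
      push_cast
      ring)
  simpa using this

/-- Conservation of the `L²` norm. -/
lemma enorm_eq (hu : IsFreeSchrodingerSolution u₀ u) {t : ℝ} (ht : 0 ≤ t) :
    ‖u t‖ₑ = ‖u₀‖ₑ := by
  have h := eLpNorm_congr_ae (p := 2) (hu.fourierInv_ae_eq ht)
  rw [eLpNorm_chirp, eLpNorm_coe_eq_enorm, eLpNorm_coe_eq_enorm, ← enorm_fourier,
    ← enorm_fourier (𝓕⁻ u₀), FourierTransform.fourier_fourierInv_eq,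
    FourierTransform.fourier_fourierInv_eq] at h
  exact h

/-- The Gaussian pairings of the solution in terms of those of the initial datum. -/
lemma gaussTransform_eq (hu : IsFreeSchrodingerSolution u₀ u) {t : ℝ} (ht : 0 ≤ t)
    {c c' : ℂ} (hc : 0 < c.re) (hc' : 0 < c'.re) (h : 1 / c' = 1 / c + 4 * Complex.I * t)
    (b : Fin n → ℂ) :
    gaussConst c' (fun i => c' * b i / c) * gaussTransform (u t) c b =
      gaussConst c b * gaussTransform u₀ c' (fun i => c' * b i / c) := by
  have hc0 : c ≠ 0 := fun h => by simp [h] at hc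
  have hc0' : c' ≠ 0 := fun h => by simp [h] at hc'
  have h1 := gaussTransform_fourier (𝓕⁻ (u t)) hc b
  have h2 := gaussTransform_fourier (𝓕⁻ u₀) hc' (fun i => c' * b i / c)
  rw [FourierTransform.fourier_fourierInv_eq] at h1 h2
  rw [h1, h2, hu.gaussTransform_fourierInv ht (pi_sq_div_re_pos hc)]
  have e1 : (Real.pi : ℂ) ^ 2 / c + Complex.I * ((2 * Real.pi) ^ 2 * t : ℝ)
      = Real.pi ^ 2 / c' := by
    rw [div_eq_mul_one_div _ c', h]
    push_cast
    ring
  have e2 : (fun i => -Complex.I * Real.pi * (c' * b i / c) / c')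
      = fun i => -Complex.I * Real.pi * b i / c := by
    ext i
    field_simp
  rw [e1, e2]
  ring

/-- The solution at time `t > 0` is, up to a constant, a chirp and a dilation, the Fourier
transform of the chirped initial datum. -/
lemma exists_ae_eq_chirp_fourier (hu : IsFreeSchrodingerSolution u₀ u) {t : ℝ} (ht : 0 < t) :
    ∃ κ : ℂ, u t =ᵐ[volume] fun x => κ * chirp (1 / (4 * t))
      (fun x => (𝓕 (chirpLp (1 / (4 * t)) u₀) : L2 n) ((4 * Real.pi * t)⁻¹ • x)) x := by
  set Q : L2 n := 𝓕 (chirpLp (1 / (4 * t)) u₀) with hQ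
  have hr : 0 < (4 * Real.pi * t)⁻¹ := by positivity
  set r := (4 * Real.pi * t)⁻¹ with hr_def
  have hpi : (Real.pi : ℂ) ≠ 0 := by exact_mod_cast Real.pi_ne_zero
  have htc : (t : ℂ) ≠ 0 := by exact_mod_cast ht.ne'
  have hrc : (r : ℂ) = ((4 : ℂ) * Real.pi * t)⁻¹ := by rw [hr_def]; push_cast; rfl
  set D : ℂ := 1 + 4 * Complex.I * t with hD
  have hDre : D.re = 1 := by simp [hD]
  have hD0 : D ≠ 0 := fun h => by simp [h] at hDre
  have hc' : 0 < (1 / D).re := by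
    rw [one_div, Complex.inv_re, hDre]
    have := Complex.normSq_pos.mpr hD0
    positivity
  set C : ℂ := (1 - Complex.I * (1 / (4 * t) : ℝ)) / r ^ 2 with hC
  have hCre : 0 < C.re := by
    rw [hC, ← Complex.ofReal_pow, Complex.div_ofReal_re]
    have : (1 - Complex.I * ((1 / (4 * t) : ℝ) : ℂ)).re = 1 := by
      rw [Complex.sub_re, Complex.I_mul_re, Complex.ofReal_im]
      simp
    rw [this]
    positivity
  have hCD : C = -Complex.I * 4 * Real.pi ^ 2 * t * D := by
    rw [hC, hrc, hD]
    push_cast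
    field_simp
    linear_combination (4 * (t : ℂ)) * Complex.I_sq
  have hC0 : C ≠ 0 := fun h => by simp [h] at hCre
  -- The `b`-independent factors of the two pairings; the `b`-dependent exponentials cancel by `hE`.
  set κ : ℂ := gaussConst 1 (0 : Fin n → ℂ) /
    (gaussConst (1 / D) (0 : Fin n → ℂ) * (((r ^ n)⁻¹ : ℝ) * gaussConst C (0 : Fin n → ℂ))) with hκ
  refine ⟨κ, ae_eq_of_gaussTransform_eq (Lp.memLp _).gaussIntegrable
    (memLp_chirp (memLp_comp_smul hr (Lp.memLp Q)) _).gaussIntegrable (c := 1) (by simp) κ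
    fun b => ?_⟩
  have h1 := hu.gaussTransform_eq ht.le (c := 1) (c' := 1 / D) (by simp) hc'
    (by rw [hD]; simp) b
  rw [gaussTransform_chirp, gaussTransform_comp_smul hr, ← hC, hQ,
    gaussTransform_fourier _ hCre, gaussTransform_congr (coeFn_chirpLp _ _),
    gaussTransform_chirp]
  have e1 : (Real.pi : ℂ) ^ 2 / C - Complex.I * (1 / (4 * t) : ℝ) = 1 / D := by
    rw [hCD]
    push_cast
    field_simp
    rw [hD]
    linear_combination (-((1 : ℂ) + 4 * Complex.I * t)) * Complex.I_sq
  have e2 : (fun i => -Complex.I * Real.pi * (b i / r) / C) = fun i => 1 / D * b i / 1 := by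
    ext i
    rw [hCD, hrc]
    field_simp
  rw [e1, e2]
  rw [gaussConst_eq 1 b, gaussConst_eq (1 / D)] at h1
  rw [gaussConst_eq C]
  have hE : Complex.exp ((∑ i, (1 / D * b i / 1) ^ 2) / (4 * (1 / D)))
      * Complex.exp ((∑ i, (b i / r) ^ 2) / (4 * C)) =
      Complex.exp ((∑ i, b i ^ 2) / (4 * 1)) := by
    rw [← Complex.exp_add]
    congr 1
    simp only [Finset.sum_div, ← Finset.sum_add_distrib]
    refine Finset.sum_congr rfl fun i _ => ?_
    rw [hCD, hrc]
    field_simp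
    rw [hD]
    linear_combination (-(4 * b i ^ 2 * (t : ℂ))) * Complex.I_sq
  have n1 := gaussConst_ne_zero hc' (0 : Fin n → ℂ)
  have n2 := gaussConst_ne_zero hCre (0 : Fin n → ℂ)
  have n3 : ((((r ^ n)⁻¹ : ℝ)) : ℂ) ≠ 0 := by
    exact_mod_cast (inv_pos.mpr (pow_pos hr n)).ne'
  have n4 := Complex.exp_ne_zero ((∑ i, (1 / D * b i / 1) ^ 2) / (4 * (1 / D)))
  rw [← hE] at h1
  have h2 : gaussTransform (u t) 1 b = gaussConst 1 (0 : Fin n → ℂ) *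
      Complex.exp ((∑ i, (b i / r) ^ 2) / (4 * C)) / gaussConst (1 / D) (0 : Fin n → ℂ) *
      gaussTransform u₀ (1 / D) (fun i => 1 / D * b i / 1) := by
    apply mul_left_cancel₀ (mul_ne_zero n1 n4)
    rw [h1]
    generalize gaussTransform u₀ (1 / D) (fun i => 1 / D * b i / 1) = X
    generalize gaussConst (1 / D) (0 : Fin n → ℂ) = Y at *
    field_simp
  rw [h2, hκ]
  generalize gaussTransform u₀ (1 / D) (fun i => 1 / D * b i / 1) = X
  generalize gaussConst (1 / D) (0 : Fin n → ℂ) = Y at *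
  generalize gaussConst C (0 : Fin n → ℂ) = Z at *
  generalize ((((r ^ n)⁻¹ : ℝ)) : ℂ) = W at *
  field_simp

/-- Exponential weights of the solution at time `t > 0` are exponential weights of the Fourier
transform of the chirped initial datum. -/
lemma eLpNorm_expLin (hu : IsFreeSchrodingerSolution u₀ u) {t : ℝ} (ht : 0 < t)
    (η : EuclideanSpace ℝ (Fin n)) :
    eLpNorm (expLin η (u t)) 2 volume =
      eLpNorm (expLin ((4 * Real.pi * t) • η) (𝓕 (chirpLp (1 / (4 * t)) u₀) : L2 n)) 2 volume := by
  obtain ⟨κ, h⟩ := hu.exists_ae_eq_chirp_fourier ht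
  set Q : L2 n := 𝓕 (chirpLp (1 / (4 * t)) u₀) with hQ
  have hr : 0 < (4 * Real.pi * t)⁻¹ := by positivity
  obtain ⟨K, hK⟩ : ∃ K : ℝ≥0∞, ∀ η : EuclideanSpace ℝ (Fin n),
      eLpNorm (expLin η (u t)) 2 volume
        = K * eLpNorm (expLin ((4 * Real.pi * t) • η) Q) 2 volume := by
    refine ⟨‖κ‖ₑ * ENNReal.ofReal |((4 * Real.pi * t)⁻¹ ^ n)⁻¹| ^ (1 / (2 : ℝ)), fun η => ?_⟩
    have e : expLin η (fun x => κ * chirp (1 / (4 * t))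
        (fun x => Q ((4 * Real.pi * t)⁻¹ • x)) x)
        = κ • chirp (1 / (4 * t))
          (fun x => expLin ((4 * Real.pi * t) • η) Q ((4 * Real.pi * t)⁻¹ • x)) := by
      ext x
      simp only [expLin, chirp, Pi.smul_apply, smul_eq_mul, inner_smul_left, inner_smul_right]
      have : (4 * Real.pi * t)⁻¹ * ((starRingEnd ℝ) (4 * Real.pi * t) * inner ℝ η x)
          = inner ℝ η x := by
        simp only [conj_trivial]
        field_simp
      rw [this]
      ring
    rw [eLpNorm_congr_ae (expLin_congr h η), e, eLpNorm_const_smul, eLpNorm_chirp,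
      eLpNorm_comp_smul hr, ← mul_assoc]
  rw [hK]
  -- `K` does not depend on `η`. At `η = 0` both norms equal that of `u₀`, so `K = 1` unless `u₀ =
  -- 0`, and `‖κ‖` need not be computed.
  have h0 := hK 0
  rw [smul_zero, expLin_zero, expLin_zero, eLpNorm_coe_eq_enorm, eLpNorm_coe_eq_enorm,
    hu.enorm_eq ht.le, hQ, enorm_fourier, enorm_chirpLp] at h0
  by_cases hz : u₀ = 0
  · have hQ0 : ‖Q‖ₑ = 0 := by rw [hQ, enorm_fourier, enorm_chirpLp, hz, enorm_zero]
    rw [enorm_eq_zero] at hQ0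
    have : expLin ((4 * Real.pi * t) • η) Q =ᵐ[volume] 0 := by
      rw [hQ0]
      filter_upwards [Lp.coeFn_zero ℂ 2 (volume : Measure (EuclideanSpace ℝ (Fin n)))] with x hx
      simp [expLin]
    rw [eLpNorm_congr_ae this, eLpNorm_zero, mul_zero]
  · have hK1 : K = 1 := by
      have h1 : ‖u₀‖ₑ ≠ 0 := by simpa using hz
      have h2 : ‖u₀‖ₑ ≠ ∞ := by simp
      have := (ENNReal.mul_left_inj (b := K) (a := 1) h1 h2).mp (by rw [one_mul]; exact h0)
      exact this.symm
    rw [hK1, one_mul]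

end IsFreeSchrodingerSolution

/-! ### Linear exponential weights and chirps. -/

lemma aestronglyMeasurable_expLin_lp (η : EuclideanSpace ℝ (Fin n)) (f : L2 n) :
    AEStronglyMeasurable (expLin η f) volume :=
  aestronglyMeasurable_expLin (Lp.aestronglyMeasurable f) η

/-- With `η = (π/k) ν`, multiplying by `exp (η · ξ)` after `𝓕` is formally the shift `x ↦ x -
iη/(2π)`, under which `exp (ik|x|²)` gains the factor `exp (ν · x)` and a phase. The pairings
express this as `exp (η · ξ) 𝓕 (chirp v) = phase · 𝓕 (chirp (𝓕⁻ H))` without any analytic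
continuation of `v`. -/
lemma gaussTransform_expLin_fourier_chirp {k : ℝ} (hk : k ≠ 0) (ν : EuclideanSpace ℝ (Fin n))
    {v g H : L2 n} (hg : g =ᵐ[volume] expLin ν v)
    (hH : H =ᵐ[volume] expLin ((Real.pi / k) • ν) (𝓕 g : L2 n)) (b : Fin n → ℂ) :
    gaussTransform (expLin ((Real.pi / k) • ν) (𝓕 (chirpLp k v) : L2 n)) 1 b =
      Complex.exp ((k / (4 * Real.pi ^ 2) * ∑ i, ((Real.pi / k) * ν i) ^ 2 : ℝ) * Complex.I) *
        gaussTransform (𝓕 (chirpLp k (𝓕⁻ H)) : L2 n) 1 b := by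
  have hpi : (Real.pi : ℂ) ≠ 0 := by exact_mod_cast Real.pi_ne_zero
  have hkc : (k : ℂ) ≠ 0 := by exact_mod_cast hk
  set η := (Real.pi / k) • ν with hη
  have hηi : ∀ i, (η i : ℂ) = Real.pi / k * ν i := fun i => by
    rw [hη, PiLp.smul_apply, smul_eq_mul]
    push_cast
    rfl
  set D : ℂ := 1 - Complex.I * (k / Real.pi ^ 2) with hD
  have hDre : D.re = 1 := by
    have : D = 1 - Complex.I * ((k / Real.pi ^ 2 : ℝ) : ℂ) := by
      rw [hD]
      push_cast
      rfl
    rw [this, Complex.sub_re, Complex.I_mul_re, Complex.ofReal_im]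
    simp
  have hD0 : D ≠ 0 := fun h => by simp [h] at hDre
  have hc' : 0 < (1 / D).re := by
    rw [one_div, Complex.inv_re, hDre]
    have := Complex.normSq_pos.mpr hD0
    positivity
  have hq1 : (Real.pi : ℂ) ^ 2 / 1 - Complex.I * k = Real.pi ^ 2 / (1 / D) := by
    rw [hD]
    field_simp
  have h1 : gaussTransform (expLin η (𝓕 (chirpLp k v) : L2 n)) 1 b =
      gaussConst 1 (fun i => b i + η i) *
        gaussTransform v (Real.pi ^ 2 / (1 / D)) (fun i => -Complex.I * Real.pi * (b i + η i)) := by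
    rw [gaussTransform_expLin, gaussTransform_fourier _ (by simp),
      gaussTransform_congr (coeFn_chirpLp _ _), gaussTransform_chirp, hq1]
    simp only [div_one]
  have h2 : gaussTransform (𝓕 (chirpLp k (𝓕⁻ H)) : L2 n) 1 b =
      gaussConst 1 b *
        gaussTransform (𝓕⁻ H : L2 n) (Real.pi ^ 2 / (1 / D)) (fun i => -Complex.I * Real.pi * b i) := by
    rw [gaussTransform_fourier _ (by simp),
      gaussTransform_congr (coeFn_chirpLp _ _), gaussTransform_chirp, hq1]
    simp only [div_one]
  have h3 : gaussTransform H (1 / D) (fun i => b i / D) = gaussConst (1 / D) (fun i => b i / D) *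
      gaussTransform (𝓕⁻ H : L2 n) (Real.pi ^ 2 / (1 / D))
        (fun i => -Complex.I * Real.pi * b i) := by
    have := gaussTransform_fourier (𝓕⁻ H) hc' (fun i => b i / D)
    rw [FourierTransform.fourier_fourierInv_eq] at this
    rw [this]
    congr 3
    ext i
    field_simp
  have h4 : gaussTransform H (1 / D) (fun i => b i / D) =
      gaussConst (1 / D) (fun i => b i / D + η i) *
      gaussTransform v (Real.pi ^ 2 / (1 / D))
        (fun i => -Complex.I * Real.pi * (b i + η i)) := by
    rw [gaussTransform_congr hH, gaussTransform_expLin, gaussTransform_fourier _ hc',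
      gaussTransform_congr hg, gaussTransform_expLin]
    congr 3
    ext i
    rw [hηi]
    field_simp
    rw [hD]
    field_simp
    linear_combination ((k : ℂ) * ν i) * Complex.I_sq
  rw [h1, h2]
  have h5 := h3.symm.trans h4
  rw [gaussConst_eq (1 / D), gaussConst_eq (1 / D) (fun i => b i / D + η i)] at h5
  rw [gaussConst_eq 1 b, gaussConst_eq 1 (fun i => b i + η i)]
  have n1 := gaussConst_ne_zero hc' (0 : Fin n → ℂ)
  have hE : Complex.exp ((k / (4 * Real.pi ^ 2) * ∑ i, ((Real.pi / k) * ν i) ^ 2 : ℝ) * Complex.I)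
      * Complex.exp ((∑ i, b i ^ 2) / (4 * 1))
      * Complex.exp ((∑ i, (b i / D + η i) ^ 2) / (4 * (1 / D)))
      = Complex.exp ((∑ i, (b i + η i) ^ 2) / (4 * 1))
        * Complex.exp ((∑ i, (b i / D) ^ 2) / (4 * (1 / D))) := by
    simp only [← Complex.exp_add]
    congr 1
    push_cast
    simp only [Finset.mul_sum, Finset.sum_mul, Finset.sum_div, ← Finset.sum_add_distrib]
    refine Finset.sum_congr rfl fun i _ => ?_
    rw [hηi]
    field_simp
    rw [hD]
    field_simp
    ring
  have n2 := Complex.exp_ne_zero ((∑ i, (b i / D) ^ 2) / (4 * (1 / D)))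
  apply mul_left_cancel₀ n2
  have h6 : Complex.exp ((∑ i, (b i / D) ^ 2) / (4 * (1 / D))) *
      gaussTransform (𝓕⁻ H : L2 n) (Real.pi ^ 2 / (1 / D)) (fun i => -Complex.I * Real.pi * b i)
      = Complex.exp ((∑ i, (b i / D + η i) ^ 2) / (4 * (1 / D))) *
        gaussTransform v (Real.pi ^ 2 / (1 / D))
        (fun i => -Complex.I * Real.pi * (b i + η i)) := by
    apply mul_left_cancel₀ n1
    rw [← mul_assoc, h5, mul_assoc]
  generalize gaussTransform (𝓕⁻ H : L2 n) _ _ = X at *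
  generalize gaussTransform v _ (fun i => -Complex.I * Real.pi * (b i + η i)) = Y at *
  linear_combination (-(gaussConst 1 (0 : Fin n → ℂ) * Y)) * hE - (Complex.exp
    ((k / (4 * Real.pi ^ 2) * ∑ i, ((Real.pi / k) * ν i) ^ 2 : ℝ) * Complex.I)
      * gaussConst 1 (0 : Fin n → ℂ) * Complex.exp ((∑ i, b i ^ 2) / (4 * 1))) * h6

/-- When the right side is finite, the weighted `𝓕 g` is an `L²` function `H`, and the left function
is the image of `H` under unitary maps and a phase. -/
lemma eLpNorm_expLin_fourier_chirp_le {k : ℝ} (hk : k ≠ 0) (ν : EuclideanSpace ℝ (Fin n))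
    {v g : L2 n} (hg : g =ᵐ[volume] expLin ν v) :
    eLpNorm (expLin ((Real.pi / k) • ν) (𝓕 (chirpLp k v) : L2 n)) 2 volume ≤
      eLpNorm (expLin ((Real.pi / k) • ν) (𝓕 g : L2 n)) 2 volume := by
  by_cases htop : eLpNorm (expLin ((Real.pi / k) • ν) (𝓕 g : L2 n)) 2 volume = ∞
  · rw [htop]
    exact le_top
  have hmem : MemLp (expLin ((Real.pi / k) • ν) (𝓕 g : L2 n)) 2 :=
    ⟨aestronglyMeasurable_expLin_lp _ _, lt_top_iff_ne_top.mpr htop⟩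
  have h := ae_eq_of_gaussTransform_eq
    ((Lp.memLp (𝓕 (chirpLp k v) : L2 n)).gaussIntegrable.expLin ((Real.pi / k) • ν))
    (Lp.memLp (𝓕 (chirpLp k (𝓕⁻ (hmem.toLp _))) : L2 n)).gaussIntegrable
    (c := 1) (by simp) _
    (gaussTransform_expLin_fourier_chirp hk ν hg hmem.coeFn_toLp)
  refine le_of_eq ?_
  rw [eLpNorm_congr_ae h]
  have e : eLpNorm (fun x => Complex.exp ((k / (4 * Real.pi ^ 2) *
      ∑ i, ((Real.pi / k) * ν i) ^ 2 : ℝ) * Complex.I) *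
        (𝓕 (chirpLp k (𝓕⁻ (hmem.toLp _))) : L2 n) x) 2 volume
      = eLpNorm (𝓕 (chirpLp k (𝓕⁻ (hmem.toLp _))) : L2 n) 2 volume :=
    eLpNorm_congr_norm_ae (.of_forall fun x => by
      rw [norm_mul, Complex.norm_exp_ofReal_mul_I, one_mul])
  rw [e, eLpNorm_coe_eq_enorm, enorm_fourier, enorm_chirpLp, ← enorm_fourier,
    FourierTransform.fourier_fourierInv_eq, ← eLpNorm_coe_eq_enorm,
    eLpNorm_congr_ae hmem.coeFn_toLp]

/-- If `g = exp (ν · x) v` is in `L²`, then exponential weights of the Fourier transform of the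
chirped function `v` can be computed from the Fourier transform of `g`. -/
lemma eLpNorm_expLin_fourier_chirp {k : ℝ} (hk : k ≠ 0) (ν : EuclideanSpace ℝ (Fin n))
    {v g : L2 n} (hg : g =ᵐ[volume] expLin ν v) :
    eLpNorm (expLin ((Real.pi / k) • ν) (𝓕 (chirpLp k v) : L2 n)) 2 volume =
      eLpNorm (expLin ((Real.pi / k) • ν) (𝓕 g : L2 n)) 2 volume := by
  refine le_antisymm (eLpNorm_expLin_fourier_chirp_le hk ν hg) ?_
  -- The reverse inequality is the same one with `-k`, `-ν` and the roles of `g` and `chirpLp k v`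
  -- exchanged; `(π/k) ν` is unchanged.
  have hg' : chirpLp k v =ᵐ[volume] expLin (-ν) (chirpLp k g) := by
    refine (coeFn_chirpLp k v).trans ?_
    refine .trans ?_ (expLin_congr ((coeFn_chirpLp k g).trans (chirp_congr hg k)) (-ν)).symm
    rw [expLin_chirp, expLin_expLin, neg_add_cancel, expLin_zero]
  have h := eLpNorm_expLin_fourier_chirp_le (neg_ne_zero.mpr hk) (-ν) hg'
  have e : chirpLp (-k) (chirpLp k g) = g := by
    refine Lp.ext ((coeFn_chirpLp _ _).trans ((chirp_congr (coeFn_chirpLp k g) _).trans ?_))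
    rw [chirp_chirp, neg_add_cancel, chirp_zero]
  rwa [e, div_neg, neg_smul_neg] at h

/-! ### Log-convexity for linear exponential weights. -/

/-- The squared `L²` norm as a Lebesgue integral. -/
noncomputable def sqInt (f : EuclideanSpace ℝ (Fin n) → ℂ) : ℝ≥0∞ := ∫⁻ x, ‖f x‖ₑ ^ 2

lemma eLpNorm_two_sq (f : EuclideanSpace ℝ (Fin n) → ℂ) :
    eLpNorm f 2 volume ^ 2 = sqInt f := by
  rw [eLpNorm_eq_lintegral_rpow_enorm_toReal (by norm_num) (by norm_num), ← ENNReal.rpow_natCast,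
    ← ENNReal.rpow_mul]
  simp [sqInt]

lemma enorm_sq_real_exp_mul (a : ℝ) (z : ℂ) :
    ‖((Real.exp a : ℝ) : ℂ) * z‖ₑ ^ 2 = ENNReal.ofReal (Real.exp (2 * a)) * ‖z‖ₑ ^ 2 := by
  rw [enorm_mul, mul_pow, ← ofReal_norm, Complex.norm_real, Real.norm_eq_abs, Real.abs_exp,
    ← ENNReal.ofReal_pow (Real.exp_pos a).le, ← Real.exp_nat_mul]
  simp

lemma sqInt_expLin (η : EuclideanSpace ℝ (Fin n)) (f : EuclideanSpace ℝ (Fin n) → ℂ) :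
    sqInt (expLin η f) =
      ∫⁻ x, ENNReal.ofReal (Real.exp (2 * inner ℝ η x)) * ‖f x‖ₑ ^ 2 := by
  simp_rw [sqInt, expLin, enorm_sq_real_exp_mul]

lemma sqInt_lp (f : L2 n) : sqInt f = ‖f‖ₑ ^ 2 := by
  rw [← eLpNorm_two_sq, eLpNorm_coe_eq_enorm]

lemma sqInt_expLin_ne_zero {f : L2 n} (hf : f ≠ 0) (η : EuclideanSpace ℝ (Fin n)) :
    sqInt (expLin η f) ≠ 0 := by
  intro h
  rw [← eLpNorm_two_sq, pow_eq_zero_iff two_ne_zero,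
    eLpNorm_eq_zero_iff (aestronglyMeasurable_expLin_lp η f) two_ne_zero] at h
  refine hf (Lp.eq_zero_iff_ae_eq_zero.mpr (h.mono fun x hx => ?_))
  simpa [expLin] using hx

/-- Hölder's inequality: weighted norms with linear exponential weights are log-convex. -/
lemma sqInt_expLin_smul_le (f : L2 n) (η : EuclideanSpace ℝ (Fin n)) {s : ℝ} (h0 : 0 ≤ s)
    (h1 : s ≤ 1) :
    sqInt (expLin (s • η) f) ≤ sqInt f ^ (1 - s) * sqInt (expLin η f) ^ s := by
  have hf : Measurable fun x => ‖f x‖ₑ ^ 2 := (Lp.stronglyMeasurable f).measurable.enorm.pow_const 2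
  have hw : Measurable fun x : EuclideanSpace ℝ (Fin n) =>
      ENNReal.ofReal (Real.exp (2 * inner ℝ η x)) := by fun_prop
  rw [sqInt_expLin η]
  refine le_trans (le_of_eq ?_) (ENNReal.lintegral_mul_norm_pow_le (p := 1 - s) (q := s)
    hf.aemeasurable (hw.mul hf).aemeasurable (by linarith) h0 (by ring))
  rw [sqInt_expLin]
  refine lintegral_congr fun x => ?_
  simp only [Pi.mul_apply]
  rw [ENNReal.mul_rpow_of_nonneg _ _ h0, ENNReal.ofReal_rpow_of_pos (Real.exp_pos _),
    ← Real.exp_mul, mul_left_comm, ← ENNReal.rpow_add_of_nonneg _ _ (by linarith) h0,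
    sub_add_cancel, ENNReal.rpow_one, inner_smul_left]
  congr 3
  simp only [conj_trivial]
  ring

lemma chirpLp_ne_zero {f : L2 n} (hf : f ≠ 0) (k : ℝ) : chirpLp k f ≠ 0 := by
  rwa [← enorm_ne_zero, enorm_chirpLp, enorm_ne_zero]

lemma fourier_ne_zero {f : L2 n} (hf : f ≠ 0) : (𝓕 f : L2 n) ≠ 0 := by
  rwa [← enorm_ne_zero, enorm_fourier, enorm_ne_zero]

/-- Log-convexity of the exponentially weighted norms of the Fourier transforms of the chirped
functions `exp (i k |x|²) v`, in the parameter `1 / k`. -/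
lemma sqInt_expLin_fourier_chirp_le {v : L2 n} (hv : v ≠ 0) {k k' : ℝ} (hk' : 0 < k')
    (hkk' : k' ≤ k) (ν : EuclideanSpace ℝ (Fin n)) :
    sqInt (expLin ((Real.pi / k) • ν) (𝓕 (chirpLp k v) : L2 n)) ≤
      sqInt (expLin ν v) ^ (1 - k' / k) *
        sqInt (expLin ((Real.pi / k') • ν) (𝓕 (chirpLp k' v) : L2 n)) ^ (k' / k) := by
  have hk : 0 < k := hk'.trans_le hkk'
  rcases hkk'.eq_or_lt with rfl | hlt
  · simp [hk.ne']
  -- The nonvanishing of `v` excludes the product `∞ · 0` on the right.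
  by_cases htop : sqInt (expLin ν v) = ∞
  · rw [htop, ENNReal.top_rpow_of_pos (by rw [sub_pos, div_lt_one hk]; exact hlt),
      ENNReal.top_mul]
    · exact le_top
    · rw [Ne, ENNReal.rpow_eq_zero_iff_of_pos (by positivity)]
      exact sqInt_expLin_ne_zero (fourier_ne_zero (chirpLp_ne_zero hv _)) _
  have hmem : MemLp (expLin ν v) 2 := by
    refine ⟨aestronglyMeasurable_expLin_lp _ _, lt_top_iff_ne_top.mpr fun h => htop ?_⟩
    rw [← eLpNorm_two_sq, h]
    simp
  have hg := hmem.coeFn_toLp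
  set g : L2 n := hmem.toLp _
  have e : ∀ l : ℝ, l ≠ 0 → sqInt (expLin ((Real.pi / l) • ν) (𝓕 (chirpLp l v) : L2 n))
      = sqInt (expLin ((Real.pi / l) • ν) (𝓕 g : L2 n)) := fun l hl => by
    rw [← eLpNorm_two_sq, eLpNorm_expLin_fourier_chirp hl ν hg, eLpNorm_two_sq]
  have e0 : sqInt (expLin ν v) = sqInt (𝓕 g : L2 n) := by
    rw [sqInt_lp, enorm_fourier, ← sqInt_lp, ← eLpNorm_two_sq, ← eLpNorm_two_sq,
      eLpNorm_congr_ae hg]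
  rw [e k hk.ne', e k' hk'.ne', e0]
  -- All norms now concern the single function `𝓕 g`, with weights proportional to `1/k`.
  have := sqInt_expLin_smul_le (𝓕 g) ((Real.pi / k') • ν) (s := k' / k) (by positivity)
    ((div_le_one hk).mpr hkk')
  rwa [smul_smul, show k' / k * (Real.pi / k') = Real.pi / k by field_simp] at this

lemma chirpLp_chirpLp (k l : ℝ) (f : L2 n) : chirpLp k (chirpLp l f) = chirpLp (k + l) f := by
  refine Lp.ext ((coeFn_chirpLp _ _).trans ((chirp_congr (coeFn_chirpLp l f) _).trans ?_))
  rw [chirp_chirp]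
  exact (coeFn_chirpLp _ _).symm

lemma chirpLp_zero (f : L2 n) : chirpLp 0 f = f := by
  refine Lp.ext ((coeFn_chirpLp _ _).trans ?_)
  rw [chirp_zero]

lemma sqInt_expLin_chirpLp (η : EuclideanSpace ℝ (Fin n)) (k : ℝ) (f : L2 n) :
    sqInt (expLin η (chirpLp k f)) = sqInt (expLin η f) := by
  rw [← eLpNorm_two_sq, ← eLpNorm_two_sq, eLpNorm_congr_ae (expLin_congr (coeFn_chirpLp k f) η),
    expLin_chirp, eLpNorm_chirp]

namespace IsFreeSchrodingerSolution

variable {u₀ : L2 n} {u : ℝ → L2 n}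

/-- Splitting the chirp `1/(4t)` as `k - α/(4β)` makes `(π/k)(1/β) = 4πt/(αt+β)`, while the datum
`exp (-iα|x|²/(4β)) u₀` is independent of `t`. -/
lemma sqInt_expLin_eq (hu : IsFreeSchrodingerSolution u₀ u) {α β t : ℝ} (hα : 0 < α) (hβ : 0 < β)
    (ht : 0 < t) (l : EuclideanSpace ℝ (Fin n)) :
    sqInt (expLin ((1 / (α * t + β)) • l) (u t)) =
      sqInt (expLin ((Real.pi / (1 / (4 * t) + α / (4 * β))) • ((1 / β) • l))
        (𝓕 (chirpLp (1 / (4 * t) + α / (4 * β)) (chirpLp (-(α / (4 * β))) u₀)) : L2 n)) := by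
  rw [← eLpNorm_two_sq, hu.eLpNorm_expLin ht, eLpNorm_two_sq, chirpLp_chirpLp, smul_smul, smul_smul,
    add_neg_cancel_right]
  congr 3
  have : 0 < α * t + β := by positivity
  field_simp
  ring

/-- Log-convexity with linear exponential weights between two times. -/
lemma sqInt_expLin_le (hu : IsFreeSchrodingerSolution u₀ u) (h0 : u₀ ≠ 0) {α β t T : ℝ}
    (hα : 0 < α) (hβ : 0 < β) (ht : 0 < t) (htT : t ≤ T) (l : EuclideanSpace ℝ (Fin n)) :
    sqInt (expLin ((1 / (α * t + β)) • l) (u t)) ≤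
      sqInt (expLin ((1 / β) • l) u₀) ^ thetaExp α β T t *
        sqInt (expLin ((1 / (α * T + β)) • l) (u T)) ^ (1 - thetaExp α β T t) := by
  have hT : 0 < T := ht.trans_le htT
  have := sqInt_expLin_fourier_chirp_le (chirpLp_ne_zero h0 (-(α / (4 * β))))
    (k := 1 / (4 * t) + α / (4 * β)) (k' := 1 / (4 * T) + α / (4 * β)) (by positivity)
    (by gcongr) ((1 / β) • l)
  rw [← hu.sqInt_expLin_eq hα hβ ht, ← hu.sqInt_expLin_eq hα hβ hT, sqInt_expLin_chirpLp] at this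
  have hθ : 1 - thetaExp α β T t =
      (1 / (4 * T) + α / (4 * β)) / (1 / (4 * t) + α / (4 * β)) := by
    have h1 : 0 < α * t + β := by positivity
    have h2 : 0 < β + t * α := by positivity
    have h3 : 0 < β + α * t := by positivity
    rw [thetaExp]
    field_simp
    ring
  rw [hθ, show thetaExp α β T t = 1 - (1 - thetaExp α β T t) by ring, hθ]
  exact this

/-- Log-convexity with linear exponential weights between the datum and its Fourier transform. -/
lemma sqInt_expLin_le_fourier (hu : IsFreeSchrodingerSolution u₀ u) (h0 : u₀ ≠ 0) {α β t : ℝ}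
    (hα : 0 < α) (hβ : 0 < β) (ht : 0 < t) (l : EuclideanSpace ℝ (Fin n)) :
    sqInt (expLin ((1 / (α * t + β)) • l) (u t)) ≤
      sqInt (expLin ((1 / β) • l) u₀) ^ muExp α β t *
        sqInt (expLin ((4 * Real.pi / α) • l) (𝓕 u₀ : L2 n)) ^ (1 - muExp α β t) := by
  have := sqInt_expLin_fourier_chirp_le (chirpLp_ne_zero h0 (-(α / (4 * β))))
    (k := 1 / (4 * t) + α / (4 * β)) (k' := α / (4 * β)) (by positivity)
    (le_add_of_nonneg_left (by positivity)) ((1 / β) • l)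
  rw [← hu.sqInt_expLin_eq hα hβ ht, sqInt_expLin_chirpLp, chirpLp_chirpLp, add_neg_cancel,
    chirpLp_zero, smul_smul, show Real.pi / (α / (4 * β)) * (1 / β) = 4 * Real.pi / α by
      field_simp] at this
  have hμ : 1 - muExp α β t = (α / (4 * β)) / (1 / (4 * t) + α / (4 * β)) := by
    have h1 : 0 < α * t + β := by positivity
    have h2 : 0 < β + t * α := by positivity
    have h3 : 0 < β + α * t := by positivity
    rw [muExp]
    field_simp
    ring
  rw [hμ, show muExp α β t = 1 - (1 - muExp α β t) by ring, hμ]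
  exact this

end IsFreeSchrodingerSolution

lemma measurable_angularFourier (f : L2 n) : Measurable (angularFourier f) :=
  ((Lp.stronglyMeasurable (𝓕 f : L2 n)).measurable.comp (measurable_const_smul _)).const_mul _

lemma sqInt_expLin_angularFourier (f : L2 n) (η : EuclideanSpace ℝ (Fin n)) :
    sqInt (expLin η (angularFourier f)) = sqInt (expLin ((2 * Real.pi) • η) (𝓕 f : L2 n)) := by
  have hr : 0 < (2 * Real.pi)⁻¹ := by positivity
  have e : expLin η (angularFourier f) = (((2 * Real.pi) ^ (-(n : ℝ) / 2) : ℝ) : ℂ) •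
      (fun x => expLin ((2 * Real.pi) • η) (𝓕 f : L2 n) ((2 * Real.pi)⁻¹ • x)) := by
    ext x
    simp only [expLin, angularFourier, Pi.smul_apply, smul_eq_mul, inner_smul_left,
      inner_smul_right]
    have : (2 * Real.pi)⁻¹ * ((starRingEnd ℝ) (2 * Real.pi) * inner ℝ η x) = inner ℝ η x := by
      simp only [conj_trivial]
      field_simp
    rw [this]
    ring
  rw [← eLpNorm_two_sq, ← eLpNorm_two_sq, e, eLpNorm_const_smul, eLpNorm_comp_smul hr, ← mul_assoc]
  -- The unitary normalization exactly offsets the Jacobian of the dilation.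
  have h1 : ‖(((2 * Real.pi) ^ (-(n : ℝ) / 2) : ℝ) : ℂ)‖ₑ *
      ENNReal.ofReal |((2 * Real.pi)⁻¹ ^ n)⁻¹| ^ (1 / (2 : ℝ)) = 1 := by
    rw [← ofReal_norm, Complex.norm_real, Real.norm_eq_abs, abs_of_pos (by positivity),
      abs_of_pos (by positivity), inv_pow, inv_inv, ENNReal.ofReal_rpow_of_pos (by positivity),
      ← ENNReal.ofReal_mul (by positivity), ← Real.rpow_natCast, ← Real.rpow_mul (by positivity),
      ← Real.rpow_add (by positivity)]
    ring_nf
    simp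
  rw [h1, one_mul]

end

/-! ### Power weights as Gaussian superpositions of linear exponentials. -/

section

lemma rpow_sub_one_mul_self {x s : ℝ} (hx : 0 ≤ x) (hs : s ≠ 0) : x ^ (s - 1) * x = x ^ s := by
  rcases hx.eq_or_lt with rfl | hx
  · rw [mul_zero, Real.zero_rpow hs]
  · rw [Real.rpow_sub_one hx.ne', div_mul_cancel₀ _ hx.ne']

/-- Weighted AM-GM. In use `a = |y|^(p/2)` and `b = |w|`, and the product of powers is `|y|
|w|^(2-2/p)`, the size of the cross term in the Bregman divergence. -/
lemma mul_rpow_mul_rpow_le {p a b : ℝ} (hp : p ∈ Ioc (1 : ℝ) 2) (ha : 0 ≤ a) (hb : 0 ≤ b) :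
    p * (a ^ (2 / p) * b ^ (2 - 2 / p)) ≤ (2 - p) * a ^ 2 + (2 * p - 2) * (a * b) := by
  have hp0 : 0 < p := by linarith [hp.1]
  have h := Real.geom_mean_le_arith_mean2_weighted (w₁ := 2 / p - 1) (w₂ := 2 - 2 / p)
    (by rw [sub_nonneg, le_div_iff₀ hp0]; linarith [hp.2])
    (by rw [sub_nonneg, div_le_iff₀ hp0]; linarith [hp.1]) ha hb (by ring)
  rw [← rpow_sub_one_mul_self ha (by positivity)]
  calc p * (a ^ (2 / p - 1) * a * b ^ (2 - 2 / p))
      = p * a * (a ^ (2 / p - 1) * b ^ (2 - 2 / p)) := by ring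
    _ ≤ p * a * ((2 / p - 1) * a + (2 - 2 / p) * b) := by gcongr
    _ = _ := by field_simp

/-- The matching lower bound, by Bernoulli: the convex function `a ↦ a^(2/p)` lies above its tangent
at `b`. -/
lemma le_mul_rpow_mul_rpow {p a b : ℝ} (hp : p ∈ Ioc (1 : ℝ) 2) (ha : 0 ≤ a) (hb : 0 ≤ b) :
    p * b ^ 2 + 2 * b * (a - b) ≤ p * (a ^ (2 / p) * b ^ (2 - 2 / p)) := by
  have hp0 : 0 < p := by linarith [hp.1]
  rcases hb.eq_or_lt with rfl | hb
  · simp only [zero_pow two_ne_zero, mul_zero, zero_mul, add_zero]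
    positivity
  have h := one_add_mul_self_le_rpow_one_add (s := a / b - 1) (p := 2 / p)
    (by linarith [div_nonneg ha hb.le]) (by rw [le_div_iff₀ hp0]; linarith [hp.2])
  rw [add_sub_cancel, Real.div_rpow ha hb.le] at h
  have e : a ^ (2 / p) * b ^ (2 - 2 / p) = b ^ 2 * (a ^ (2 / p) / b ^ (2 / p)) := by
    rw [Real.rpow_sub hb, Real.rpow_two]
    ring
  rw [e]
  calc p * b ^ 2 + 2 * b * (a - b) = p * (b ^ 2 * (1 + 2 / p * (a / b - 1))) := by
        field_simp
    _ ≤ _ := by gcongr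

/-- `κ` is the cosine of the angle between the vectors. For `κ ≥ 0` the bound on `G` gives the
factor `p - 1`; for `κ ≤ 0` the cross term has the good sign, and half is lost in `a² - 2abκ + b² ≤
2(a² + b²)`. -/
lemma quadratic_le_bregman {p a b κ G : ℝ} (hp : p ∈ Ioc (1 : ℝ) 2)
    (hG : 0 ≤ G) (hκ : |κ| ≤ 1)
    (h1 : p * G ≤ (2 - p) * a ^ 2 + (2 * p - 2) * (a * b)) :
    (p - 1) / 2 * (a ^ 2 - 2 * (a * b * κ) + b ^ 2) ≤ a ^ 2 + (p - 1) * b ^ 2 - p * G * κ := by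
  obtain ⟨hp1, hp2⟩ := hp
  obtain ⟨hκ1, hκ2⟩ := abs_le.mp hκ
  rcases le_total 0 κ with h | h
  · have e1 := mul_le_mul_of_nonneg_right h1 h
    have e2 : 0 ≤ (2 - p) * a ^ 2 * (1 - κ) := by
      have : 0 ≤ 2 - p := by linarith
      have : 0 ≤ 1 - κ := by linarith
      positivity
    have e3 : 0 ≤ (p - 1) * (a ^ 2 - 2 * (a * b * κ) + b ^ 2) := by
      have : 0 ≤ p - 1 := by linarith
      have : 0 ≤ a ^ 2 - 2 * (a * b * κ) + b ^ 2 := by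
        nlinarith [sq_nonneg (a - b * κ), mul_nonneg (sq_nonneg b) (by nlinarith : 0 ≤ 1 - κ ^ 2)]
      positivity
    nlinarith
  · have e1 : 0 ≤ p * G * (-κ) := by
      have : 0 ≤ -κ := by linarith
      positivity
    have e2 : -2 * (a * b * κ) ≤ a ^ 2 + b ^ 2 := by
      nlinarith [sq_nonneg (a + b * κ), mul_nonneg (sq_nonneg b) (by nlinarith : 0 ≤ 1 - κ ^ 2)]
    have e3 : (p - 1) / 2 * (a ^ 2 - 2 * (a * b * κ) + b ^ 2)
        ≤ (p - 1) / 2 * (2 * (a ^ 2 + b ^ 2)) :=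
      mul_le_mul_of_nonneg_left (by linarith) (by linarith)
    nlinarith [mul_nonneg (by linarith : 0 ≤ 2 - p) (sq_nonneg a)]

/-- For `κ ≥ 0` the factor `1` would do; for `κ ≤ 0` the cross term adds at most `a² + b²`, whence
`3`. -/
lemma bregman_le_quadratic {p a b κ G : ℝ} (hp : p ∈ Ioc (1 : ℝ) 2)
    (ha : 0 ≤ a) (hb : 0 ≤ b) (hκ : |κ| ≤ 1)
    (h1 : p * G ≤ (2 - p) * a ^ 2 + (2 * p - 2) * (a * b))
    (h2 : p * b ^ 2 + 2 * b * (a - b) ≤ p * G) :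
    a ^ 2 + (p - 1) * b ^ 2 - p * G * κ ≤ 3 * (a ^ 2 - 2 * (a * b * κ) + b ^ 2) := by
  obtain ⟨hp1, hp2⟩ := hp
  obtain ⟨hκ1, hκ2⟩ := abs_le.mp hκ
  rcases le_total 0 κ with h | h
  · have e1 := mul_le_mul_of_nonneg_right h2 h
    have e2 : 0 ≤ (2 - p) * b ^ 2 * (1 - κ) := by
      have : 0 ≤ 2 - p := by linarith
      have : 0 ≤ 1 - κ := by linarith
      positivity
    have e3 : 0 ≤ a ^ 2 - 2 * (a * b * κ) + b ^ 2 := by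
      nlinarith [sq_nonneg (a - b * κ), mul_nonneg (sq_nonneg b) (by nlinarith : 0 ≤ 1 - κ ^ 2)]
    nlinarith
  · have e0 : p * G ≤ a ^ 2 + b ^ 2 := by
      nlinarith [mul_nonneg (by linarith : 0 ≤ p - 1) (sq_nonneg (a - b)),
        mul_nonneg (by linarith : 0 ≤ 2 - p) (sq_nonneg b)]
    have e1 : p * G * (-κ) ≤ a ^ 2 + b ^ 2 := by
      have : (a ^ 2 + b ^ 2) * (-κ) ≤ a ^ 2 + b ^ 2 := by nlinarith [sq_nonneg a, sq_nonneg b]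
      nlinarith
    have e2 : 0 ≤ a * b * (-κ) := by
      have : 0 ≤ -κ := by linarith
      positivity
    nlinarith [mul_nonneg (by linarith : 0 ≤ 2 - p) (sq_nonneg b), sq_nonneg a]

variable {n : ℕ}

/-- The frequency `p |w|^(1 - 2/p) w`, the gradient of `|·|^p` at `|w|^(2/p - 1) w`. -/
noncomputable def powFreq (p : ℝ) (w : EuclideanSpace ℝ (Fin n)) : EuclideanSpace ℝ (Fin n) :=
  (p * ‖w‖ ^ (1 - 2 / p)) • w

/-- The vector `|y|^(p/2 - 1) y`. -/
noncomputable def powCenter (p : ℝ) (y : EuclideanSpace ℝ (Fin n)) : EuclideanSpace ℝ (Fin n) :=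
  ‖y‖ ^ (p / 2 - 1) • y

/-- The middle expression is the Bregman divergence of `|·|^p` between `y` and `z = |w|^(2/p-1) w`,
since `|z|^p = |w|²` and the gradient at `z` is `powFreq p w`. -/
lemma bregman_bounds {p : ℝ} (hp : p ∈ Ioc (1 : ℝ) 2) (y w : EuclideanSpace ℝ (Fin n)) :
    (p - 1) / 2 * ‖powCenter p y - w‖ ^ 2 ≤
        ‖y‖ ^ p - inner ℝ (powFreq p w) y + (p - 1) * ‖w‖ ^ 2 ∧
      ‖y‖ ^ p - inner ℝ (powFreq p w) y + (p - 1) * ‖w‖ ^ 2 ≤ 3 * ‖powCenter p y - w‖ ^ 2 := by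
  have hp0 : 0 < p := by linarith [hp.1]
  set κ := inner ℝ w y / (‖w‖ * ‖y‖) with hκ_def
  have hκ : |κ| ≤ 1 := abs_real_inner_div_norm_mul_norm_le_one w y
  have hin : inner ℝ w y = κ * (‖w‖ * ‖y‖) := by
    by_cases h : ‖w‖ * ‖y‖ = 0
    · rcases mul_eq_zero.mp h with h' | h' <;> rw [norm_eq_zero] at h' <;> simp [h']
    · rw [hκ_def, div_mul_cancel₀ _ h]
  set a := ‖y‖ ^ (p / 2) with ha_def
  set b := ‖w‖
  have ha : 0 ≤ a := by positivity
  have hb : 0 ≤ b := norm_nonneg w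
  have hy : ‖y‖ = a ^ (2 / p) := by
    rw [ha_def, ← Real.rpow_mul (norm_nonneg y), show p / 2 * (2 / p) = 1 by field_simp,
      Real.rpow_one]
  have hyp : ‖y‖ ^ p = a ^ 2 := by
    rw [ha_def, ← Real.rpow_natCast, ← Real.rpow_mul (norm_nonneg y)]
    congr 1
    push_cast
    ring
  have hfreq : inner ℝ (powFreq p w) y = p * (a ^ (2 / p) * b ^ (2 - 2 / p)) * κ := by
    rw [powFreq, inner_smul_left, hin, hy, ← rpow_sub_one_mul_self hb (s := 2 - 2 / p),
      show 2 - 2 / p - 1 = 1 - 2 / p by ring]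
    · simp only [conj_trivial]
      ring
    · rw [sub_ne_zero]
      exact ((div_lt_iff₀ hp0).mpr (by linarith [hp.1])).ne'
  have hcn : ‖powCenter p y‖ ^ 2 = a ^ 2 := by
    rw [powCenter, norm_smul, Real.norm_eq_abs, abs_of_nonneg (by positivity),
      rpow_sub_one_mul_self (norm_nonneg y) (by positivity)]
  have hci : inner ℝ (powCenter p y) w = a * b * κ := by
    rw [powCenter, inner_smul_left, real_inner_comm, hin, ha_def,
      ← rpow_sub_one_mul_self (norm_nonneg y) (s := p / 2) (by positivity)]
    simp only [conj_trivial]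
    ring
  have hsq : ‖powCenter p y - w‖ ^ 2 = a ^ 2 - 2 * (a * b * κ) + b ^ 2 := by
    rw [norm_sub_sq_real, hcn, hci]
  have h1 := mul_rpow_mul_rpow_le hp ha hb
  have h2 := le_mul_rpow_mul_rpow hp ha hb
  have hG : 0 ≤ a ^ (2 / p) * b ^ (2 - 2 / p) := by positivity
  rw [hsq, hyp, hfreq]
  have e1 := quadratic_le_bregman hp hG hκ h1
  have e2 := bregman_le_quadratic hp ha hb hκ h1 h2
  constructor <;> linarith

/-- The Gaussian integral `∫ exp (-a |w|²) dw` as a Lebesgue integral. -/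
noncomputable def gaussMass (n : ℕ) (a : ℝ) : ℝ≥0∞ :=
  ∫⁻ w : EuclideanSpace ℝ (Fin n), ENNReal.ofReal (Real.exp (-a * ‖w‖ ^ 2))

lemma gaussMass_ne_top {a : ℝ} (ha : 0 < a) : gaussMass n a ≠ ∞ := by
  have h := GaussianFourier.integrable_cexp_neg_mul_sq_norm_add (b := (a : ℂ))
    (V := EuclideanSpace ℝ (Fin n)) (by simpa using ha) 0 0
  have h2 : Integrable fun w : EuclideanSpace ℝ (Fin n) => Real.exp (-a * ‖w‖ ^ 2) := by
    refine h.norm.congr (.of_forall fun w => ?_)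
    simp only [Complex.norm_exp, zero_mul, add_zero]
    congr 1
    norm_cast
  exact h2.lintegral_lt_top.ne

lemma gaussMass_ne_zero (a : ℝ) : gaussMass n a ≠ 0 := by
  rw [gaussMass, Ne, lintegral_eq_zero_iff (by fun_prop)]
  intro h
  obtain ⟨w, hw⟩ := h.exists
  exact absurd (ENNReal.ofReal_eq_zero.mp hw) (not_le.mpr (Real.exp_pos _))

lemma lintegral_gauss_sub (a : ℝ) (y : EuclideanSpace ℝ (Fin n)) :
    ∫⁻ w, ENNReal.ofReal (Real.exp (-a * ‖y - w‖ ^ 2)) = gaussMass n a :=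
  lintegral_sub_left_eq_self
    (fun w : EuclideanSpace ℝ (Fin n) => ENNReal.ofReal (Real.exp (-a * ‖w‖ ^ 2))) y

/-- The Gaussian weight of the superposition. -/
noncomputable def superWeight (p : ℝ) (w : EuclideanSpace ℝ (Fin n)) : ℝ≥0∞ :=
  ENNReal.ofReal (Real.exp (-(2 * (p - 1)) * ‖w‖ ^ 2))

/-- The superposition of linear exponentials comparable to `exp (2 |y|^p)`. -/
noncomputable def superExp (p : ℝ) (y : EuclideanSpace ℝ (Fin n)) : ℝ≥0∞ :=
  ∫⁻ w, superWeight p w * ENNReal.ofReal (Real.exp (2 * inner ℝ (powFreq p w) y))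

/-- Twice the lower Bregman bound leaves a Gaussian in `w` centred at `powCenter p y`, whose mass
does not depend on `y`. The companion bound uses the upper estimate, with `6 = 2 · 3`. -/
lemma superExp_le {p : ℝ} (hp : p ∈ Ioc (1 : ℝ) 2) (y : EuclideanSpace ℝ (Fin n)) :
    superExp p y ≤ gaussMass n (p - 1) * ENNReal.ofReal (Real.exp (2 * ‖y‖ ^ p)) := by
  rw [← lintegral_gauss_sub _ (powCenter p y), ← lintegral_mul_const _ (by fun_prop)]
  refine lintegral_mono fun w => ?_
  rw [superWeight, ← ENNReal.ofReal_mul (Real.exp_pos _).le, ← Real.exp_add,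
    ← ENNReal.ofReal_mul (Real.exp_pos _).le, ← Real.exp_add]
  refine ENNReal.ofReal_le_ofReal (Real.exp_le_exp.mpr ?_)
  linarith [(bregman_bounds hp y w).1]

lemma le_superExp {p : ℝ} (hp : p ∈ Ioc (1 : ℝ) 2) (y : EuclideanSpace ℝ (Fin n)) :
    gaussMass n 6 * ENNReal.ofReal (Real.exp (2 * ‖y‖ ^ p)) ≤ superExp p y := by
  rw [← lintegral_gauss_sub _ (powCenter p y), ← lintegral_mul_const _ (by fun_prop)]
  refine lintegral_mono fun w => ?_
  rw [superWeight, ← ENNReal.ofReal_mul (Real.exp_pos _).le, ← Real.exp_add,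
    ← ENNReal.ofReal_mul (Real.exp_pos _).le, ← Real.exp_add]
  refine ENNReal.ofReal_le_ofReal (Real.exp_le_exp.mpr ?_)
  linarith [(bregman_bounds hp y w).2]

lemma measurable_powFreq (p : ℝ) :
    Measurable (powFreq p : EuclideanSpace ℝ (Fin n) → EuclideanSpace ℝ (Fin n)) := by
  unfold powFreq
  fun_prop

lemma measurable_superWeight (p : ℝ) :
    Measurable (superWeight p : EuclideanSpace ℝ (Fin n) → ℝ≥0∞) := by
  unfold superWeight
  fun_prop

lemma measurable_uncurry_expWeight (p r : ℝ) {f : EuclideanSpace ℝ (Fin n) → ℂ}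
    (hf : Measurable f) :
    Measurable fun z : EuclideanSpace ℝ (Fin n) × EuclideanSpace ℝ (Fin n) =>
      ENNReal.ofReal (Real.exp (2 * inner ℝ (r • powFreq p z.1) z.2)) * ‖f z.2‖ₑ ^ 2 := by
  have h1 : Measurable fun z : EuclideanSpace ℝ (Fin n) × EuclideanSpace ℝ (Fin n) =>
      r • powFreq p z.1 := ((measurable_powFreq p).comp measurable_fst).const_smul r
  have h2 := h1.inner (𝕜 := ℝ) (measurable_snd (α := EuclideanSpace ℝ (Fin n)))
  have h3 : Measurable fun z : EuclideanSpace ℝ (Fin n) × EuclideanSpace ℝ (Fin n) =>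
    ‖f z.2‖ₑ ^ 2 := (hf.comp measurable_snd).enorm.pow_const 2
  exact (Real.measurable_exp.comp (h2.const_mul 2)).ennreal_ofReal.mul h3

lemma measurable_sqInt_expLin (p r : ℝ) {f : EuclideanSpace ℝ (Fin n) → ℂ} (hf : Measurable f) :
    Measurable fun w : EuclideanSpace ℝ (Fin n) => sqInt (expLin (r • powFreq p w) f) := by
  simp_rw [sqInt_expLin]
  exact (measurable_uncurry_expWeight p r hf).lintegral_prod_right'

lemma lintegral_superWeight_mul (p r : ℝ) {f : EuclideanSpace ℝ (Fin n) → ℂ}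
    (hf : Measurable f) :
    ∫⁻ w, superWeight p w * sqInt (expLin (r • powFreq p w) f) =
      ∫⁻ x, superExp p (r • x) * ‖f x‖ₑ ^ 2 := by
  have hm := measurable_uncurry_expWeight p r hf
  have h1 : ∀ w : EuclideanSpace ℝ (Fin n), superWeight p w * sqInt (expLin (r • powFreq p w) f)
      = ∫⁻ x, superWeight p w *
        (ENNReal.ofReal (Real.exp (2 * inner ℝ (r • powFreq p w) x)) * ‖f x‖ₑ ^ 2) := by
    intro w
    have hw : Measurable fun x : EuclideanSpace ℝ (Fin n) =>
      ENNReal.ofReal (Real.exp (2 * inner ℝ (r • powFreq p w) x)) := by fun_prop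
    rw [sqInt_expLin]
    exact (lintegral_const_mul _ (hw.mul (hf.enorm.pow_const 2))).symm
  simp_rw [h1]
  rw [lintegral_lintegral_swap
    (((measurable_superWeight p).comp measurable_fst).mul hm).aemeasurable]
  refine lintegral_congr fun x => ?_
  have hmx : Measurable fun w => superWeight p w *
      ENNReal.ofReal (Real.exp (2 * inner ℝ (powFreq p w) (r • x))) :=
    (measurable_superWeight p).mul (Real.measurable_exp.comp
      (((measurable_powFreq p).inner measurable_const).const_mul 2)).ennreal_ofReal
  rw [superExp, ← lintegral_mul_const _ hmx]
  refine lintegral_congr fun w => ?_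
  rw [mul_assoc]
  simp only [inner_smul_left, inner_smul_right, conj_trivial]

lemma expPowNorm_sq (p r : ℝ) (f : EuclideanSpace ℝ (Fin n) → ℂ) :
    expPowNorm p r f ^ 2 = ∫⁻ x, ENNReal.ofReal (Real.exp (2 * ‖r • x‖ ^ p)) * ‖f x‖ₑ ^ 2 := by
  rw [expPowNorm, eLpNorm_two_sq]
  simp_rw [sqInt, enorm_sq_real_exp_mul]

lemma measurable_expPow_mul (p r : ℝ) {f : EuclideanSpace ℝ (Fin n) → ℂ} (hf : Measurable f) :
    Measurable fun x => ENNReal.ofReal (Real.exp (2 * ‖r • x‖ ^ p)) * ‖f x‖ₑ ^ 2 := by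
  have : Measurable fun x : EuclideanSpace ℝ (Fin n) =>
    ENNReal.ofReal (Real.exp (2 * ‖r • x‖ ^ p)) := by fun_prop
  exact this.mul (hf.enorm.pow_const 2)

lemma lintegral_superWeight_le {p : ℝ} (hp : p ∈ Ioc (1 : ℝ) 2) (r : ℝ)
    {f : EuclideanSpace ℝ (Fin n) → ℂ} (hf : Measurable f) :
    ∫⁻ w, superWeight p w * sqInt (expLin (r • powFreq p w) f) ≤
      gaussMass n (p - 1) * expPowNorm p r f ^ 2 := by
  rw [lintegral_superWeight_mul p r hf, expPowNorm_sq,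
    ← lintegral_const_mul _ (measurable_expPow_mul p r hf)]
  refine lintegral_mono fun x => ?_
  rw [← mul_assoc]
  gcongr
  exact superExp_le hp _

lemma le_lintegral_superWeight {p : ℝ} (hp : p ∈ Ioc (1 : ℝ) 2) (r : ℝ)
    {f : EuclideanSpace ℝ (Fin n) → ℂ} (hf : Measurable f) :
    gaussMass n 6 * expPowNorm p r f ^ 2 ≤
      ∫⁻ w, superWeight p w * sqInt (expLin (r • powFreq p w) f) := by
  rw [lintegral_superWeight_mul p r hf, expPowNorm_sq,
    ← lintegral_const_mul _ (measurable_expPow_mul p r hf)]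
  refine lintegral_mono fun x => ?_
  rw [← mul_assoc]
  gcongr
  exact le_superExp hp _

/-! ### Transfer of log-convexity to power weights, and conclusion. -/

/-- The constant in the interpolation inequalities. -/
noncomputable def interpConst (n : ℕ) (p : ℝ) : ℝ :=
  1 + (gaussMass n (p - 1) / gaussMass n 6).toReal

lemma one_le_interpConst (n : ℕ) (p : ℝ) : 1 ≤ interpConst n p :=
  le_add_of_nonneg_right ENNReal.toReal_nonneg

lemma gaussMass_le_interpConst {p : ℝ} (hp : p ∈ Ioc (1 : ℝ) 2) :
    gaussMass n (p - 1) ≤ gaussMass n 6 * ENNReal.ofReal (interpConst n p) ^ 2 := by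
  have h1 := gaussMass_ne_top (n := n) (sub_pos.mpr hp.1)
  have h6 := gaussMass_ne_top (n := n) (a := 6) (by norm_num)
  have h60 := gaussMass_ne_zero (n := n) 6
  have hd : gaussMass n (p - 1) / gaussMass n 6 ≠ ∞ := ENNReal.div_ne_top h1 h60
  calc gaussMass n (p - 1) = gaussMass n 6 * (gaussMass n (p - 1) / gaussMass n 6) :=
        (ENNReal.mul_div_cancel h60 h6).symm
    _ ≤ gaussMass n 6 * ENNReal.ofReal (interpConst n p) ^ 2 := by
        gcongr
        rw [← ENNReal.ofReal_pow (by linarith [one_le_interpConst n p]),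
          ← ENNReal.ofReal_toReal hd]
        refine ENNReal.ofReal_le_ofReal ?_
        have : 0 ≤ (gaussMass n (p - 1) / gaussMass n 6).toReal := ENNReal.toReal_nonneg
        rw [interpConst]
        nlinarith

/-- Log-convexity with respect to all linear exponential weights passes to the weights
`exp (|r x|^p)`. -/
lemma expPowNorm_le_of_sqInt_expLin_le {p : ℝ} (hp : p ∈ Ioc (1 : ℝ) 2) {r r₀ r₁ θ : ℝ}
    (hθ0 : 0 ≤ θ) (hθ1 : θ ≤ 1) {f f₀ f₁ : EuclideanSpace ℝ (Fin n) → ℂ} (hf : Measurable f)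
    (hf₀ : Measurable f₀) (hf₁ : Measurable f₁)
    (h : ∀ l : EuclideanSpace ℝ (Fin n), sqInt (expLin (r • l) f) ≤
      sqInt (expLin (r₀ • l) f₀) ^ θ * sqInt (expLin (r₁ • l) f₁) ^ (1 - θ)) :
    expPowNorm p r f ≤ ENNReal.ofReal (interpConst n p) * expPowNorm p r₀ f₀ ^ θ *
      expPowNorm p r₁ f₁ ^ (1 - θ) := by
  have hθ1' : 0 ≤ 1 - θ := by linarith
  -- The exponents sum to `1`, so `superWeight` can be shared between the two factors before Hölder
  -- in `w`, and the common constant recombined afterwards.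
  have split : ∀ X Y Z : ℝ≥0∞, (X * Y) ^ θ * (X * Z) ^ (1 - θ) = X * (Y ^ θ * Z ^ (1 - θ)) := by
    intro X Y Z
    rw [ENNReal.mul_rpow_of_nonneg _ _ hθ0, ENNReal.mul_rpow_of_nonneg _ _ hθ1',
      mul_mul_mul_comm, ← ENNReal.rpow_add_of_nonneg _ _ hθ0 hθ1', add_sub_cancel,
      ENNReal.rpow_one]
  have key : gaussMass n 6 * expPowNorm p r f ^ 2 ≤ gaussMass n 6 *
      (ENNReal.ofReal (interpConst n p) * expPowNorm p r₀ f₀ ^ θ *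
        expPowNorm p r₁ f₁ ^ (1 - θ)) ^ 2 :=
    calc gaussMass n 6 * expPowNorm p r f ^ 2
        ≤ ∫⁻ w, superWeight p w * sqInt (expLin (r • powFreq p w) f) :=
          le_lintegral_superWeight hp r hf
      _ ≤ ∫⁻ w, (superWeight p w * sqInt (expLin (r₀ • powFreq p w) f₀)) ^ θ *
            (superWeight p w * sqInt (expLin (r₁ • powFreq p w) f₁)) ^ (1 - θ) := by
          refine lintegral_mono fun w => ?_
          rw [split]
          gcongr
          exact h _
      _ ≤ (∫⁻ w, superWeight p w * sqInt (expLin (r₀ • powFreq p w) f₀)) ^ θ *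
            (∫⁻ w, superWeight p w * sqInt (expLin (r₁ • powFreq p w) f₁)) ^ (1 - θ) :=
          ENNReal.lintegral_mul_norm_pow_le
            ((measurable_superWeight p).mul (measurable_sqInt_expLin p r₀ hf₀)).aemeasurable
            ((measurable_superWeight p).mul (measurable_sqInt_expLin p r₁ hf₁)).aemeasurable
            hθ0 hθ1' (by ring)
      _ ≤ (gaussMass n (p - 1) * expPowNorm p r₀ f₀ ^ 2) ^ θ *
            (gaussMass n (p - 1) * expPowNorm p r₁ f₁ ^ 2) ^ (1 - θ) := by
          gcongr
          · exact lintegral_superWeight_le hp r₀ hf₀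
          · exact lintegral_superWeight_le hp r₁ hf₁
      _ = gaussMass n (p - 1) * ((expPowNorm p r₀ f₀ ^ 2) ^ θ *
            (expPowNorm p r₁ f₁ ^ 2) ^ (1 - θ)) := split _ _ _
      _ ≤ gaussMass n 6 * ENNReal.ofReal (interpConst n p) ^ 2 * ((expPowNorm p r₀ f₀ ^ 2) ^ θ *
            (expPowNorm p r₁ f₁ ^ 2) ^ (1 - θ)) := by
          gcongr
          exact gaussMass_le_interpConst hp
      _ = _ := by
          simp only [← ENNReal.rpow_natCast, ← ENNReal.rpow_mul, mul_comm _ θ,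
            mul_comm _ (1 - θ)]
          simp only [ENNReal.rpow_mul, ENNReal.rpow_natCast]
          ring
  rw [ENNReal.mul_le_mul_iff_right (gaussMass_ne_zero 6)
    (gaussMass_ne_top (by norm_num))] at key
  exact (ENNReal.pow_le_pow_left_iff two_ne_zero).mp key

lemma measurable_lp (f : L2 n) : Measurable f := (Lp.stronglyMeasurable f).measurable

lemma expPowNorm_zero (p r : ℝ) {f : L2 n} (hf : f = 0) : expPowNorm p r f = 0 := by
  have : (fun x => ((Real.exp (‖r • x‖ ^ p) : ℝ) : ℂ) * f x) =ᵐ[volume] 0 := by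
    rw [hf]
    filter_upwards [Lp.coeFn_zero ℂ 2 (volume : Measure (EuclideanSpace ℝ (Fin n)))] with x hx
    simp
  rw [expPowNorm, eLpNorm_congr_ae this, eLpNorm_zero]

end

theorem corollary3p3 (n : ℕ) (hn : 1 ≤ n) (p : ℝ) (hp : p ∈ Set.Ioc (1 : ℝ) 2) :
    ∃ c : ℝ, 0 < c ∧
      ∀ (α β : ℝ), 0 < α → 0 < β →
      ∀ (u₀ : L2 n) (u : ℝ → L2 n), IsFreeSchrodingerSolution u₀ u →
        (∀ T : ℝ, 0 < T → ∀ t ∈ Set.Icc (0 : ℝ) T,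
          expPowNorm p (1 / (α * t + β)) (u t) ≤
            ENNReal.ofReal c
              * expPowNorm p (1 / β) u₀ ^ thetaExp α β T t
              * expPowNorm p (1 / (α * T + β)) (u T) ^ (1 - thetaExp α β T t)) ∧
        (∀ t : ℝ, 0 ≤ t →
          expPowNorm p (1 / (α * t + β)) (u t) ≤
            ENNReal.ofReal c
              * expPowNorm p (1 / β) u₀ ^ muExp α β t
              * expPowNorm p (2 / α) (angularFourier u₀) ^ (1 - muExp α β t)) := by
  refine ⟨interpConst n p, by linarith [one_le_interpConst n p],
    fun α β hα hβ u₀ u hu => ?_⟩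
  -- Needed at `t = 0`, where both exponents `θ` and `μ` equal `1` and the inequality compares a
  -- norm with `c` times itself.
  have hc : 1 ≤ ENNReal.ofReal (interpConst n p) := by
    rw [ENNReal.one_le_ofReal]
    exact one_le_interpConst n p
  by_cases h0 : u₀ = 0
  · have hz : ∀ t, 0 ≤ t → u t = 0 := fun t ht => by
      rw [← enorm_eq_zero, hu.enorm_eq ht, h0, enorm_zero]
    refine ⟨fun T hT t ht => ?_, fun t ht => ?_⟩
    · rw [expPowNorm_zero _ _ (hz t ht.1)]
      exact zero_le
    · rw [expPowNorm_zero _ _ (hz t ht)]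
      exact zero_le
  have start : ∀ X : ℝ≥0∞, expPowNorm p (1 / (α * 0 + β)) (u 0) ≤
      ENNReal.ofReal (interpConst n p) * expPowNorm p (1 / β) u₀ ^ (1 : ℝ) *
        X ^ (1 - 1 : ℝ) := fun X => by
    rw [hu.initial, mul_zero, zero_add, sub_self, ENNReal.rpow_zero, ENNReal.rpow_one, mul_one]
    exact le_mul_of_one_le_left zero_le hc
  refine ⟨fun T hT t ht => ?_, fun t ht => ?_⟩
  · rcases ht.1.eq_or_lt with rfl | htpos
    · have e : thetaExp α β T 0 = 1 := by
        rw [thetaExp]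
        field_simp
        ring
      rw [e]
      exact start _
    · have hd : 0 < α * t + β := by positivity
      refine expPowNorm_le_of_sqInt_expLin_le hp ?_ ?_ (measurable_lp _) (measurable_lp _)
        (measurable_lp _) (hu.sqInt_expLin_le h0 hα hβ htpos ht.2)
      · have := sub_nonneg.mpr ht.2
        rw [thetaExp]
        positivity
      · rw [thetaExp, div_le_one (by positivity)]
        nlinarith [mul_pos hT (mul_pos hα htpos), mul_pos hβ htpos]
  · rcases ht.eq_or_lt with rfl | htpos
    · have e : muExp α β 0 = 1 := by
        rw [muExp, mul_zero, zero_add, div_self hβ.ne']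
      rw [e]
      exact start _
    · have hd : 0 < α * t + β := by positivity
      refine expPowNorm_le_of_sqInt_expLin_le hp ?_ ?_ (measurable_lp _) (measurable_lp _)
        (measurable_angularFourier _) fun l => ?_
      · rw [muExp]
        positivity
      · rw [muExp, div_le_one hd]
        nlinarith [mul_pos hα htpos]
      -- The angular weight `2/α` becomes `4π/α` in the frequency variable of `𝓕`.
      · rw [sqInt_expLin_angularFourier, smul_smul,
          show 2 * Real.pi * (2 / α) = 4 * Real.pi / α by ring]
        exact hu.sqInt_expLin_le_fourier h0 hα hβ htpos l
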